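/- Theorem. On a real random access machine, the following holds for some fixed program and some absolute constant $C$. Let $P=\langle p_1,\dots,p_n\rangle$, $n\ge 1$, be a polyline with vertices in $\mathbb{R}^2$ and let $\varepsilon\ge 0$. A simplification of $P$ is a polyline $Q=\langle p_{i_1},\dots,p_{i_\kappa}\rangle$ with $1=i_1<i_2<\dots<i_\kappa=n$ whose Fréchet distance to $P$ is at most $\varepsilon$; here the Fréchet distance of two curves $f,g:[0,1]\to\mathbb{R}^2$ is $$\inf_{\alpha,\beta}\ \max_{t\in[0,1]}\ \|f(\alpha(t))-g(\beta(t))\|,$$ where $\alpha,\beta$ range over the continuous nondecreasing maps of $[0,1]$ onto itself. Let $k$ be the minimum number of vertices of a simplification of $P$. Given $n$, the coordinates of $p_1,\dots,p_n$ and $\varepsilon$, the program computes the indices $i_1<\dots<i_k$ of a simplification of $P$ with $k$ vertices, in at most $C\,k\,n^5$ steps and using at most $C\,k\,n^2$ memory cells of each of its two memories. In short, an optimal simplification is computed in $O(kn^5)$ time and $O(kn^2)$ space. The machine has a fixed finite number of registers, an integer memory and a real memory. One step is one of: an addition, truncated subtraction or multiplication of integers; an addition, subtraction, multiplication or division of real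 numbers, or a square root of a nonnegative real number; loading an integer constant, or copying a register; a conversion of an integer into a real number; a memory access at an address held in an integer register; a jump; a comparison of two integers or of two real numbers, followed by a conditional jump. Integers are nonnegative words below $C\,k\,n^2$, and real numbers are exact. -/

import Mathlib

/-! ## Curves, the Fréchet distance, polylines and their simplifications -/

/-- The Euclidean plane `ℝ²`. -/
abbrev Plane : Type := EuclideanSpace ℝ (Fin 2)

/-- The nondecreasing continuous reparametrizations of `[0, 1]` that fix the two end points
(these are exactly the nondecreasing continuous surjections of `[0, 1]` onto itself). -/
def Reparam : Type :=
  {α : C(unitInterval, unitInterval) // Monotone α ∧ α 0 = 0 ∧ α 1 = 1}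

/-- The Fréchet distance of two curves in the plane: the infimum, over all pairs of
reparametrizations `α`, `β`, of `max_t ‖f (α t) - g (β t)‖`. (The distance on the space
`C([0, 1], ℝ²)` of continuous maps is the maximum distance.) -/
noncomputable def frechetDist (f g : C(unitInterval, Plane)) : ℝ :=
  ⨅ r : Reparam × Reparam, dist (f.comp r.1.1) (g.comp r.2.1)

/-- The polyline `⟨p 0, …, p m⟩` with `m + 1` vertices and `m` edges, as a parametrized curve:
it visits `p i` at time `i / m` and has constant speed on each of the time intervals
`[i / m, (i + 1) / m]`. Edge `i` contributes its full vector after time `(i + 1) / m`, nothing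
before time `i / m`, and the proportional part in between. -/
noncomputable def polyline {m : ℕ} (p : Fin (m + 1) → Plane) : C(unitInterval, Plane) where
  toFun t := p 0 + ∑ i : Fin m,
    (max 0 (min 1 ((m : ℝ) * (t : ℝ) - (i : ℕ)))) • (p i.succ - p i.castSucc)
  continuous_toFun := by fun_prop

/-- `σ` selects a simplification with `l + 1` vertices of the polyline `P`: the vertices
`P (σ 0), …, P (σ l)` form a subsequence of the vertices of `P` that keeps the first and the
last one, and the polyline through them has Fréchet distance at most `ε` to `P`. -/
structure IsSimplification {m l : ℕ} (P : Fin (m + 1) → Plane) (ε : ℝ)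
    (σ : Fin (l + 1) → Fin (m + 1)) : Prop where
  strictMono : StrictMono σ
  first : σ 0 = 0
  last : σ (Fin.last l) = Fin.last m
  dist_le : frechetDist (polyline (P ∘ σ)) (polyline P) ≤ ε

/-- A simplification with the minimum number of vertices. -/
def IsOptimalSimplification {m l : ℕ} (P : Fin (m + 1) → Plane) (ε : ℝ)
    (σ : Fin (l + 1) → Fin (m + 1)) : Prop :=
  IsSimplification P ε σ ∧
    ∀ (l' : ℕ) (τ : Fin (l' + 1) → Fin (m + 1)), IsSimplification P ε τ → l + 1 ≤ l' + 1

/-! ## The real random access machine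

The machine has integer registers and real registers (a program mentions only finitely many of
them), and an integer memory and a real memory, which are addressed indirectly through the integer
registers. Integer data are bounded words. There is no conversion of reals to integers: the control
flow depends on real data only through comparisons. Every instruction costs one step. -/

namespace RealRAM

/-- The instructions. Register operands are written `d` (destination), `a`, `b` (sources). -/
inductive Instr : Type
  /-- `N[d] := v` -/
  | nConst (d v : ℕ)
  /-- `N[d] := N[a]` -/
  | nCopy (d a : ℕ)
  /-- `N[d] := N[a] + N[b]` -/
  | nAdd (d a b : ℕ)
  /-- `N[d] := max (N[a] - N[b]) 0` -/
  | nSub (d a b : ℕ)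
  /-- `N[d] := N[a] * N[b]` -/
  | nMul (d a b : ℕ)
  /-- `N[d] := integer memory at address N[a]` -/
  | nLoad (d a : ℕ)
  /-- `integer memory at address N[a] := N[b]` -/
  | nStore (a b : ℕ)
  /-- `R[d] := N[a]` -/
  | rOfNat (d a : ℕ)
  /-- `R[d] := R[a]` -/
  | rCopy (d a : ℕ)
  /-- `R[d] := R[a] + R[b]` -/
  | rAdd (d a b : ℕ)
  /-- `R[d] := R[a] - R[b]` -/
  | rSub (d a b : ℕ)
  /-- `R[d] := R[a] * R[b]` -/
  | rMul (d a b : ℕ)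
  /-- `R[d] := R[a] / R[b]`, provided that `R[b] ≠ 0` -/
  | rDiv (d a b : ℕ)
  /-- `R[d] := √R[a]`, provided that `R[a] ≥ 0` -/
  | rSqrt (d a : ℕ)
  /-- `R[d] := real memory at address N[a]` -/
  | rLoad (d a : ℕ)
  /-- `real memory at address N[a] := R[b]` -/
  | rStore (a b : ℕ)
  /-- go to instruction number `l` -/
  | jump (l : ℕ)
  /-- if `N[a] < N[b]`, go to instruction number `l` -/
  | nJumpLt (a b l : ℕ)
  /-- if `R[a] < R[b]`, go to instruction number `l` -/
  | rJumpLt (a b l : ℕ)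
  /-- stop -/
  | halt

/-- A configuration: program counter, integer and real registers, integer and real memory. -/
structure Config : Type where
  pc : ℕ
  nReg : ℕ → ℕ
  rReg : ℕ → ℝ
  nMem : ℕ → ℕ
  rMem : ℕ → ℝ

/-- Write the word `v` to integer register `d` and advance. A machine of size `S` can only hold
integers below `S`; on overflow it crashes. -/
def Config.setN (S : ℕ) (c : Config) (d v : ℕ) : Option Config :=
  if v < S then some { c with pc := c.pc + 1, nReg := Function.update c.nReg d v } else none

/-- Write the real number `v` to real register `d` and advance. -/
def Config.setR (c : Config) (d : ℕ) (v : ℝ) : Config :=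
  { c with pc := c.pc + 1, rReg := Function.update c.rReg d v }

/-- Execute one instruction on a machine of size `S`: each of the two memories consists of the `S`
cells with addresses below `S`, and integers are words with values below `S`. The result is `none`
if the machine has halted or crashes (access beyond the memory, overflow, undefined operation). -/
noncomputable def exec (S : ℕ) (c : Config) : Instr → Option Config
  | .nConst d v => c.setN S d v
  | .nCopy d a => c.setN S d (c.nReg a)
  | .nAdd d a b => c.setN S d (c.nReg a + c.nReg b)
  | .nSub d a b => c.setN S d (c.nReg a - c.nReg b)
  | .nMul d a b => c.setN S d (c.nReg a * c.nReg b)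
  | .nLoad d a => if c.nReg a < S then c.setN S d (c.nMem (c.nReg a)) else none
  | .nStore a b =>
      if c.nReg a < S then
        some { c with pc := c.pc + 1, nMem := Function.update c.nMem (c.nReg a) (c.nReg b) }
      else none
  | .rOfNat d a => some (c.setR d (c.nReg a))
  | .rCopy d a => some (c.setR d (c.rReg a))
  | .rAdd d a b => some (c.setR d (c.rReg a + c.rReg b))
  | .rSub d a b => some (c.setR d (c.rReg a - c.rReg b))
  | .rMul d a b => some (c.setR d (c.rReg a * c.rReg b))
  | .rDiv d a b => if c.rReg b ≠ 0 then some (c.setR d (c.rReg a / c.rReg b)) else none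
  | .rSqrt d a => if 0 ≤ c.rReg a then some (c.setR d (Real.sqrt (c.rReg a))) else none
  | .rLoad d a => if c.nReg a < S then some (c.setR d (c.rMem (c.nReg a))) else none
  | .rStore a b =>
      if c.nReg a < S then
        some { c with pc := c.pc + 1, rMem := Function.update c.rMem (c.nReg a) (c.rReg b) }
      else none
  | .jump l => some { c with pc := l }
  | .nJumpLt a b l => some { c with pc := if c.nReg a < c.nReg b then l else c.pc + 1 }
  | .rJumpLt a b l => some { c with pc := if c.rReg a < c.rReg b then l else c.pc + 1 }
  | .halt => none

/-- One step of the program `prog` on a machine of size `S`. -/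
noncomputable def step (S : ℕ) (prog : List Instr) (c : Config) : Option Config :=
  (prog[c.pc]?).bind (exec S c)

/-- The configuration after exactly `t` steps, if the machine runs that long without crashing. -/
noncomputable def run (S : ℕ) (prog : List Instr) : ℕ → Config → Option Config
  | 0, c => some c
  | t + 1, c => (step S prog c).bind (run S prog t)

/-- The program counter points at a `halt` instruction. -/
def Halted (prog : List Instr) (c : Config) : Prop := prog[c.pc]? = some .halt

/-- Started in `c`, the program halts after at most `T` steps on a machine of size `S`
(so it uses at most `S` cells of each memory) in the configuration `c'`. -/
def HaltsWithin (S T : ℕ) (prog : List Instr) (c c' : Config) : Prop :=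
  ∃ t ≤ T, run S prog t c = some c' ∧ Halted prog c'

end RealRAM

/-- The initial configuration for a polyline `P` with `m + 1` vertices and a threshold `ε`: the
number of vertices is in integer register `0`, `ε` is in real register `0`, and the real memory
holds the coordinates `x 0, y 0, x 1, y 1, …, x m, y m`. Everything else is zero. -/
noncomputable def inputConfig {m : ℕ} (P : Fin (m + 1) → Plane) (ε : ℝ) : RealRAM.Config where
  pc := 0
  nReg := fun j => if j = 0 then m + 1 else 0
  rReg := fun j => if j = 0 then ε else 0
  nMem := fun _ => 0
  rMem := fun j =>
    if h : j / 2 < m + 1 then P ⟨j / 2, h⟩ ⟨j % 2, Nat.mod_lt j Nat.two_pos⟩ else 0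

/-- The configuration `c` presents the index sequence `σ` as output: its length is in integer
register `0` and its entries are in the integer memory, from address `0` on. -/
def IsOutput {m l : ℕ} (c : RealRAM.Config) (σ : Fin (l + 1) → Fin (m + 1)) : Prop :=
  c.nReg 0 = l + 1 ∧ ∀ j : Fin (l + 1), c.nMem j = σ j

/-!
The program computes, level by level, a table that describes reachability in the free space of the
input polyline `p 0, …, p m` and all its candidate simplifications. If a polyline with `a` links
that ends in vertex `i` matches the input up to some point of edge `j` that is close to `p i`, then
it also matches the input up to every later point of this edge that is close to `p i`: one waits at
`p i`, and disks are convex. So it suffices to store, for all `a`, `i`, `j`, the least parameter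
`table a i j` on edge `j` that can be reached (`2` if there is none), together with the preceding
vertex and edge. This takes `O(n ^ 2)` cells per level, and the number of levels is the number of
links of an optimal simplification, since the computation stops at the first level at which the end
of the input is reached.

A level is computed from the preceding one by one sweep for each link from `p c` to `p i`. The free
space of a link and an edge is convex, so on the common boundary of two such cells the reachable
part of the free interval is determined by its least parameter, which is the first point of a
segment, beyond a given parameter, in a disk (`firstHit`, the smaller root of a quadratic polynomial
or that parameter itself). A sweep takes `O(n)` steps, hence a level takes `O(n ^ 3)` steps, and the
whole computation `O(k n ^ 3)`, within the bound `O(k n ^ 5)`.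

The table is tied to the Fréchet distance through `LinkMatch`, which describes a matching of a link
with a part of the input by finitely many parameters. In one direction (`isSimplification_trace`),
matched links yield monotone paths in the free space, and concatenated paths yield
reparametrizations. In the other one (`IsSimplification.table_le_one`), reparametrizations yield, at
the times at which vertices are visited, a finite system of parameters (`IsMatching`). The infimum
in the definition of the Fréchet distance is attained by such systems, because they form a compact
set; this makes up for the fact that reparametrizations are only given for every bound above `ε`.

The program is written in a small structured language whose compilation to machine code is proved
correct once and for all by rules for a weakest precondition with a time bound (`Wp`). The program
computes exactly the functions of the mathematical part, and `sweepCmd_spec`, `levelCmd_spec` and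
`traceCmd_spec` carry its verification.
-/

/-! ### Structured programs for the random access machine -/

namespace RealRAM

/-- The data part of a configuration: everything except the program counter. -/
structure Store : Type where
  n : ℕ → ℕ
  r : ℕ → ℝ
  nm : ℕ → ℕ
  rm : ℕ → ℝ

namespace Store

/-- The configuration with data `s` and program counter `pc`. -/
def config (s : Store) (pc : ℕ) : Config := ⟨pc, s.n, s.r, s.nm, s.rm⟩

/-- Write an integer register. -/
def setN (s : Store) (d v : ℕ) : Store := { s with n := Function.update s.n d v }

/-- Write a real register. -/
def setR (s : Store) (d : ℕ) (v : ℝ) : Store := { s with r := Function.update s.r d v }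

/-- Write a cell of the integer memory. -/
def setNM (s : Store) (d v : ℕ) : Store := { s with nm := Function.update s.nm d v }

/-- Write a cell of the real memory. -/
def setRM (s : Store) (d : ℕ) (v : ℝ) : Store := { s with rm := Function.update s.rm d v }

variable (s : Store) (d k v : ℕ) (x : ℝ)

@[simp] theorem setN_n : (s.setN d v).n k = if k = d then v else s.n k := by
  simp [setN, Function.update_apply]
@[simp] theorem setN_r : (s.setN d v).r = s.r := rfl
@[simp] theorem setN_nm : (s.setN d v).nm = s.nm := rfl
@[simp] theorem setN_rm : (s.setN d v).rm = s.rm := rfl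
@[simp] theorem setR_n : (s.setR d x).n = s.n := rfl
@[simp] theorem setR_r : (s.setR d x).r k = if k = d then x else s.r k := by
  simp [setR, Function.update_apply]
@[simp] theorem setR_nm : (s.setR d x).nm = s.nm := rfl
@[simp] theorem setR_rm : (s.setR d x).rm = s.rm := rfl
@[simp] theorem setNM_n : (s.setNM d v).n = s.n := rfl
@[simp] theorem setNM_r : (s.setNM d v).r = s.r := rfl
@[simp] theorem setNM_nm : (s.setNM d v).nm k = if k = d then v else s.nm k := by
  simp [setNM, Function.update_apply]
@[simp] theorem setNM_rm : (s.setNM d v).rm = s.rm := rfl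
@[simp] theorem setRM_n : (s.setRM d x).n = s.n := rfl
@[simp] theorem setRM_r : (s.setRM d x).r = s.r := rfl
@[simp] theorem setRM_nm : (s.setRM d x).nm = s.nm := rfl
@[simp] theorem setRM_rm : (s.setRM d x).rm k = if k = d then x else s.rm k := by
  simp [setRM, Function.update_apply]

@[simp] theorem setN_setN (w : ℕ) : (s.setN d v).setN d w = s.setN d w := by
  simp [setN]

end Store

/-- The weakest precondition of a straight-line program: the code runs from `s` without crashing,
and `Q` holds afterwards. Control instructions are not allowed in straight-line code. -/
def BlockPost (S : ℕ) (Q : Store → Prop) : List Instr → Store → Prop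
  | [], s => Q s
  | .nConst d v :: is, s => v < S ∧ BlockPost S Q is (s.setN d v)
  | .nCopy d a :: is, s => s.n a < S ∧ BlockPost S Q is (s.setN d (s.n a))
  | .nAdd d a b :: is, s => s.n a + s.n b < S ∧ BlockPost S Q is (s.setN d (s.n a + s.n b))
  | .nSub d a b :: is, s => s.n a - s.n b < S ∧ BlockPost S Q is (s.setN d (s.n a - s.n b))
  | .nMul d a b :: is, s => s.n a * s.n b < S ∧ BlockPost S Q is (s.setN d (s.n a * s.n b))
  | .nLoad d a :: is, s =>
      s.n a < S ∧ s.nm (s.n a) < S ∧ BlockPost S Q is (s.setN d (s.nm (s.n a)))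
  | .nStore a b :: is, s => s.n a < S ∧ BlockPost S Q is (s.setNM (s.n a) (s.n b))
  | .rOfNat d a :: is, s => BlockPost S Q is (s.setR d (s.n a))
  | .rCopy d a :: is, s => BlockPost S Q is (s.setR d (s.r a))
  | .rAdd d a b :: is, s => BlockPost S Q is (s.setR d (s.r a + s.r b))
  | .rSub d a b :: is, s => BlockPost S Q is (s.setR d (s.r a - s.r b))
  | .rMul d a b :: is, s => BlockPost S Q is (s.setR d (s.r a * s.r b))
  | .rDiv d a b :: is, s => s.r b ≠ 0 ∧ BlockPost S Q is (s.setR d (s.r a / s.r b))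
  | .rSqrt d a :: is, s => 0 ≤ s.r a ∧ BlockPost S Q is (s.setR d (Real.sqrt (s.r a)))
  | .rLoad d a :: is, s => s.n a < S ∧ BlockPost S Q is (s.setR d (s.rm (s.n a)))
  | .rStore a b :: is, s => s.n a < S ∧ BlockPost S Q is (s.setRM (s.n a) (s.r b))
  | .jump _ :: _, _ => False
  | .nJumpLt _ _ _ :: _, _ => False
  | .rJumpLt _ _ _ :: _, _ => False
  | .halt :: _, _ => False

/-- A comparison of two integer registers or of two real registers. -/
inductive Cond : Type
  | nLt (a b : ℕ)
  | rLt (a b : ℕ)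

/-- The comparison succeeds. -/
def Cond.Holds : Cond → Store → Prop
  | .nLt a b, s => s.n a < s.n b
  | .rLt a b, s => s.r a < s.r b

/-- The conditional jump that performs the comparison. -/
def Cond.instr : Cond → ℕ → Instr
  | .nLt a b, l => .nJumpLt a b l
  | .rLt a b, l => .rJumpLt a b l

/-- Structured programs. -/
inductive Cmd : Type
  | block (is : List Instr)
  | seq (c d : Cmd)
  | cond (b : Cond) (c d : Cmd)
  | loop (b : Cond) (c : Cmd)

/-- The number of machine instructions of a structured program. -/
def Cmd.length : Cmd → ℕ
  | .block is => is.length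
  | .seq c d => c.length + d.length
  | .cond _ c d => d.length + c.length + 2
  | .loop _ c => c.length + 2

/-- The machine code of a structured program that is placed at address `o`. A loop has its test
behind its body and is entered through a jump to the test. -/
def Cmd.compile : Cmd → ℕ → List Instr
  | .block is, _ => is
  | .seq c d, o => c.compile o ++ d.compile (o + c.length)
  | .cond b c d, o =>
      b.instr (o + 1 + d.length + 1) :: (d.compile (o + 1) ++
        (.jump (o + 1 + d.length + 1 + c.length) :: c.compile (o + 1 + d.length + 1)))
  | .loop b c, o => .jump (o + 1 + c.length) :: (c.compile (o + 1) ++ [b.instr (o + 1)])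

theorem Cmd.length_compile (c : Cmd) (o : ℕ) : (c.compile o).length = c.length := by
  induction c generalizing o with
  | block is => rfl
  | seq c d hc hd => simp [compile, length, hc, hd]
  | cond b c d hc hd => simp [compile, length, hc, hd]; omega
  | loop b c hc => simp [compile, length, hc]

/-- The instructions `code` stand in `prog` from address `o` on. -/
def CodeAt (prog : List Instr) (o : ℕ) (code : List Instr) : Prop :=
  ∃ u v, prog = u ++ code ++ v ∧ u.length = o

theorem CodeAt.left {prog : List Instr} {o : ℕ} {x y : List Instr}
    (h : CodeAt prog o (x ++ y)) : CodeAt prog o x := by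
  obtain ⟨u, v, rfl, hu⟩ := h
  exact ⟨u, y ++ v, by simp, hu⟩

theorem CodeAt.right {prog : List Instr} {o : ℕ} {x y : List Instr}
    (h : CodeAt prog o (x ++ y)) : CodeAt prog (o + x.length) y := by
  obtain ⟨u, v, rfl, hu⟩ := h
  exact ⟨u ++ x, v, by simp, by simp [hu]⟩

theorem CodeAt.tail {prog : List Instr} {o : ℕ} {i : Instr} {y : List Instr}
    (h : CodeAt prog o (i :: y)) : CodeAt prog (o + 1) y :=
  CodeAt.right (x := [i]) h

theorem CodeAt.head {prog : List Instr} {o : ℕ} {i : Instr} {y : List Instr}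
    (h : CodeAt prog o (i :: y)) : prog[o]? = some i := by
  obtain ⟨u, v, rfl, rfl⟩ := h
  simp

theorem run_add (S : ℕ) (prog : List Instr) (t u : ℕ) (c : Config) :
    run S prog (t + u) c = (run S prog t c).bind (run S prog u) := by
  induction t generalizing c with
  | zero => simp [run]
  | succ t ih =>
    rw [Nat.add_right_comm]
    simp only [run]
    cases step S prog c with
    | none => rfl
    | some c' => simpa using ih c'

theorem run_one (S : ℕ) (prog : List Instr) (c : Config) : run S prog 1 c = step S prog c := by
  simp only [run]
  cases step S prog c <;> rfl

/-- On a machine of size `S`, the code of `c` runs from the data `s` within `T` steps through to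
its end, wherever it is placed in a program, and `Q` holds afterwards. -/
def Wp (S : ℕ) (c : Cmd) (T : ℕ) (s : Store) (Q : Store → Prop) : Prop :=
  ∀ prog o, CodeAt prog o (c.compile o) →
    ∃ t ≤ T, ∃ s', run S prog t (s.config o) = some (s'.config (o + c.length)) ∧ Q s'

theorem Wp.mono {S : ℕ} {c : Cmd} {T T' : ℕ} {s : Store} {Q Q' : Store → Prop}
    (h : Wp S c T s Q) (hT : T ≤ T') (hQ : ∀ s', Q s' → Q' s') : Wp S c T' s Q' := by
  intro prog o hc
  obtain ⟨t, ht, s', hr, hs⟩ := h prog o hc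
  exact ⟨t, ht.trans hT, s', hr, hQ _ hs⟩

theorem Wp.seq {S : ℕ} {c d : Cmd} {T U : ℕ} {s : Store} {Q R : Store → Prop}
    (hc : Wp S c T s Q) (hd : ∀ s', Q s' → Wp S d U s' R) : Wp S (c.seq d) (T + U) s R := by
  intro prog o h
  simp only [Cmd.compile] at h
  obtain ⟨t, ht, s₁, hr, hs⟩ := hc prog o h.left
  have h2 := h.right
  rw [Cmd.length_compile] at h2
  obtain ⟨u, hu, s₂, hr', hs'⟩ := hd s₁ hs prog _ h2
  refine ⟨t + u, by omega, s₂, ?_, hs'⟩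
  rw [run_add, hr, Option.bind_some, hr', Cmd.length, add_assoc]

theorem run_cons {S : ℕ} {prog : List Instr} {t : ℕ} {c c' : Config} {i : Instr}
    (hi : prog[c.pc]? = some i) (he : exec S c i = some c') :
    run S prog (t + 1) c = run S prog t c' := by
  simp [run, step, hi, he]

theorem Wp.block {S T : ℕ} {is : List Instr} {s : Store} {Q : Store → Prop}
    (hT : is.length ≤ T) (h : BlockPost S Q is s) : Wp S (.block is) T s Q := by
  intro prog o hc
  simp only [Cmd.compile] at hc
  refine ⟨is.length, hT, ?_⟩
  clear hT
  simp only [Cmd.length]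
  induction is generalizing s o with
  | nil => exact ⟨s, rfl, h⟩
  | cons i is ih =>
    have key : ∀ s₁ : Store, exec S (s.config o) i = some (s₁.config (o + 1)) →
        BlockPost S Q is s₁ → ∃ s', run S prog (i :: is).length (s.config o) =
          some (s'.config (o + (i :: is).length)) ∧ Q s' := by
      intro s₁ he hb
      obtain ⟨s', hr, hq⟩ := ih hb (o + 1) hc.tail
      refine ⟨s', ?_, hq⟩
      rw [List.length_cons, run_cons (c := s.config o) hc.head he, hr, add_assoc, add_comm 1]
    cases i <;> simp only [BlockPost] at h <;>
    first
    | exact key _ rfl h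
    | exact False.elim h
    | refine key _ ?_ h.2; exact if_pos h.1
    | refine key _ ?_ h.2.2; exact (if_pos h.1).trans (if_pos h.2.1)

theorem exec_cond (S : ℕ) (b : Cond) (s : Store) (o l : ℕ) [Decidable (b.Holds s)] :
    exec S (s.config o) (b.instr l) = some (s.config (if b.Holds s then l else o + 1)) := by
  cases b <;> simp only [Cond.instr, exec, Store.config, Cond.Holds] <;> congr

theorem Wp.cond {S : ℕ} {b : Cond} {c d : Cmd} {T : ℕ} {s : Store} {Q : Store → Prop}
    (hc : b.Holds s → Wp S c T s Q) (hd : ¬ b.Holds s → Wp S d T s Q) :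
    Wp S (.cond b c d) (T + 2) s Q := by
  classical
  intro prog o h
  simp only [Cmd.compile] at h
  have hj := h.tail.right
  rw [Cmd.length_compile] at hj
  by_cases hb : b.Holds s
  · obtain ⟨t, ht, s', hr, hq⟩ := hc hb prog _ hj.tail
    refine ⟨t + 1, by omega, s', ?_, hq⟩
    rw [run_cons (c := s.config o) h.head (exec_cond S b s o _), if_pos hb, hr]
    congr 2
    simp only [Cmd.length]
    omega
  · obtain ⟨t, ht, s', hr, hq⟩ := hd hb prog _ h.tail.left
    refine ⟨t + 1 + 1, by omega, s', ?_, hq⟩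
    rw [run_cons (c := s.config o) h.head (exec_cond S b s o _), if_neg hb, run_add, hr,
      Option.bind_some, run_one, step]
    have : (s'.config (o + 1 + d.length)).pc = o + 1 + d.length := rfl
    rw [this, hj.head]
    simp only [Option.bind_some, exec, Store.config, Cmd.length]
    congr 2
    omega

/-- A loop that performs exactly `N` rounds, with an invariant that is indexed by the number of
completed rounds. -/
theorem Wp.loop {S : ℕ} {b : Cond} {c : Cmd} {T N : ℕ} {s : Store} (I : ℕ → Store → Prop)
    (h0 : I 0 s)
    (hstep : ∀ k < N, ∀ s', I k s' → b.Holds s' ∧ Wp S c T s' (I (k + 1)))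
    (hend : ∀ s', I N s' → ¬ b.Holds s') :
    Wp S (.loop b c) (N * (T + 1) + 2) s (I N) := by
  classical
  intro prog o h
  simp only [Cmd.compile] at h
  have hb := h.tail.right.head
  rw [Cmd.length_compile] at hb
  have main : ∀ k, k ≤ N → ∀ s', I (N - k) s' → ∃ t ≤ k * (T + 1) + 1, ∃ s'',
      run S prog t (s'.config (o + 1 + c.length)) = some (s''.config (o + c.length + 2)) ∧
        I N s'' := by
    intro k
    induction k with
    | zero =>
      intro _ s' hs'
      refine ⟨1, by omega, s', ?_, hs'⟩
      rw [run_cons (t := 0) (c := s'.config (o + 1 + c.length)) hb (exec_cond S b s' _ _),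
        if_neg (hend _ hs'), run]
      congr 2
      omega
    | succ k ih =>
      intro hk s' hs'
      obtain ⟨hbs, hw⟩ := hstep (N - (k + 1)) (by omega) s' hs'
      obtain ⟨t, ht, s₁, hr, hI⟩ := hw prog _ h.tail.left
      rw [show N - (k + 1) + 1 = N - k by omega] at hI
      obtain ⟨u, hu, s₂, hr', hI'⟩ := ih (by omega) s₁ hI
      refine ⟨t + u + 1, by rw [Nat.succ_mul]; omega, s₂, ?_, hI'⟩
      rw [run_cons (c := s'.config (o + 1 + c.length)) hb (exec_cond S b s' _ _), if_pos hbs,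
        run_add, hr, Option.bind_some, hr']
  obtain ⟨t, ht, s', hr, hI⟩ := main N le_rfl s (by simpa using h0)
  refine ⟨t + 1, by omega, s', ?_, hI⟩
  rw [run_cons (c := s.config o) h.head rfl]
  exact hr

end RealRAM

/-! ### The first point of a segment in a disk -/

/-- The least `t` in `[x, 1]` with `A * t ^ 2 - 2 * b * t + c ≤ 0`, and `2` if there is none.
It is assumed that `0 ≤ x` and `0 ≤ A`, and that `b = 0` if `A = 0`. -/
noncomputable def firstRoot (x A b c : ℝ) : ℝ :=
  if 0 < A then
    if b * b - A * c < 0 then 2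
    else if 1 < max x ((b - √(b * b - A * c)) / A) then 2
    else if (b + √(b * b - A * c)) / A < max x ((b - √(b * b - A * c)) / A) then 2
    else max x ((b - √(b * b - A * c)) / A)
  else if 0 < c then 2
  else if 1 < x then 2
  else x

theorem firstRoot_nonneg {x A b c : ℝ} (hx : 0 ≤ x) : 0 ≤ firstRoot x A b c := by
  unfold firstRoot
  split_ifs <;> positivity

/-- For `A > 0`, the quadratic polynomial is `≤ 0` exactly between its roots. -/
theorem quadratic_nonpos_iff {A b c t : ℝ} (hA : 0 < A) (hD : 0 ≤ b * b - A * c) :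
    A * t ^ 2 - 2 * b * t + c ≤ 0 ↔
      (b - √(b * b - A * c)) / A ≤ t ∧ t ≤ (b + √(b * b - A * c)) / A := by
  have h1 : A * t ^ 2 - 2 * b * t + c ≤ 0 ↔ (A * t - b) ^ 2 ≤ b * b - A * c := by
    constructor
    · intro h; nlinarith [mul_nonneg hA.le (neg_nonneg.2 h)]
    · intro h
      by_contra h'
      nlinarith [mul_pos hA (not_le.1 h')]
  rw [h1, div_le_iff₀ hA, le_div_iff₀ hA, ← Real.sqrt_le_sqrt_iff hD, Real.sqrt_sq_eq_abs, abs_le]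
  constructor <;> rintro ⟨h, h'⟩ <;> constructor <;> linarith

theorem firstRoot_spec {x A b c : ℝ} (hA : 0 ≤ A) (hb : A = 0 → b = 0)
    (h : firstRoot x A b c ≤ 1) :
    x ≤ firstRoot x A b c ∧
      A * firstRoot x A b c ^ 2 - 2 * b * firstRoot x A b c + c ≤ 0 := by
  unfold firstRoot at h ⊢
  split_ifs at h ⊢ with h1 h2 h3 h4 h5 h6 <;> try norm_num at h
  · refine ⟨le_max_left _ _, (quadratic_nonpos_iff h1 (not_lt.1 h2)).2 ⟨le_max_right _ _, ?_⟩⟩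
    exact not_lt.1 h4
  · have hA0 : A = 0 := le_antisymm (not_lt.1 h1) hA
    simpa [hA0, hb hA0] using h5

theorem firstRoot_le {x A b c t : ℝ} (hA : 0 ≤ A) (hb : A = 0 → b = 0) (hx : x ≤ t) (ht : t ≤ 1)
    (h : A * t ^ 2 - 2 * b * t + c ≤ 0) : firstRoot x A b c ≤ t := by
  unfold firstRoot
  by_cases hA0 : 0 < A
  · have hD : 0 ≤ b * b - A * c := by
      nlinarith [sq_nonneg (A * t - b), mul_nonneg hA (neg_nonneg.2 h)]
    obtain ⟨h1, h2⟩ := (quadratic_nonpos_iff hA0 hD).1 h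
    have h3 := max_le hx h1
    rw [if_pos hA0, if_neg (not_lt.2 hD), if_neg (not_lt.2 (h3.trans ht)),
      if_neg (not_lt.2 (h3.trans h2))]
    exact h3
  · have hA0' : A = 0 := le_antisymm (not_lt.1 hA0) hA
    have hc : c ≤ 0 := by simpa [hA0', hb hA0'] using h
    rw [if_neg hA0, if_neg (not_lt.2 hc), if_neg (not_lt.2 (hx.trans ht))]
    exact hx

/-- The least `t` in `[x, 1]` for which the point `(1 - t) q + t r` has distance at most `ε` to
`p`, and `2` if there is none. -/
noncomputable def firstHit (ε x : ℝ) (p q r : Plane) : ℝ :=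
  firstRoot x
    ((r 0 - q 0) * (r 0 - q 0) + (r 1 - q 1) * (r 1 - q 1))
    ((p 0 - q 0) * (r 0 - q 0) + (p 1 - q 1) * (r 1 - q 1))
    ((p 0 - q 0) * (p 0 - q 0) + (p 1 - q 1) * (p 1 - q 1) - ε * ε)

theorem dist_lineMap_le_iff {ε : ℝ} (hε : 0 ≤ ε) (t : ℝ) (p q r : Plane) :
    dist (AffineMap.lineMap q r t) p ≤ ε ↔
      ((r 0 - q 0) * (r 0 - q 0) + (r 1 - q 1) * (r 1 - q 1)) * t ^ 2 -
        2 * ((p 0 - q 0) * (r 0 - q 0) + (p 1 - q 1) * (r 1 - q 1)) * t +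
        ((p 0 - q 0) * (p 0 - q 0) + (p 1 - q 1) * (p 1 - q 1) - ε * ε) ≤ 0 := by
  rw [EuclideanSpace.dist_eq, Real.sqrt_le_left hε, Fin.sum_univ_two, Real.dist_eq, Real.dist_eq,
    sq_abs, sq_abs, ← sub_nonpos]
  simp only [AffineMap.lineMap_apply, vsub_eq_sub, vadd_eq_add, PiLp.add_apply, PiLp.smul_apply,
    PiLp.sub_apply, smul_eq_mul]
  ring_nf

theorem firstHit_nonneg {ε x : ℝ} (hx : 0 ≤ x) (p q r : Plane) : 0 ≤ firstHit ε x p q r :=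
  firstRoot_nonneg hx

theorem eq_zero_of_mul_self_add_mul_self {u v y z : ℝ} (h : u * u + v * v = 0) :
    y * u + z * v = 0 := by
  have hu : u = 0 := by nlinarith [mul_self_nonneg u, mul_self_nonneg v]
  have hv : v = 0 := by nlinarith [mul_self_nonneg u, mul_self_nonneg v]
  simp [hu, hv]

theorem firstHit_spec {ε x : ℝ} (hε : 0 ≤ ε) {p q r : Plane} (h : firstHit ε x p q r ≤ 1) :
    x ≤ firstHit ε x p q r ∧ dist (AffineMap.lineMap q r (firstHit ε x p q r)) p ≤ ε := by
  rw [dist_lineMap_le_iff hε]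
  exact firstRoot_spec (add_nonneg (mul_self_nonneg _) (mul_self_nonneg _))
    eq_zero_of_mul_self_add_mul_self h

theorem firstHit_le {ε x t : ℝ} (hε : 0 ≤ ε) {p q r : Plane} (hx : x ≤ t) (ht : t ≤ 1)
    (h : dist (AffineMap.lineMap q r t) p ≤ ε) : firstHit ε x p q r ≤ t :=
  firstRoot_le (add_nonneg (mul_self_nonneg _) (mul_self_nonneg _))
    eq_zero_of_mul_self_add_mul_self hx ht ((dist_lineMap_le_iff hε t p q r).1 h)

/-! ### The dynamic program -/

section DynamicProgram

variable (ε : ℝ) (p : ℕ → Plane)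

/-- A sweep over the column of the free space diagram that belongs to the link from `p c` to `p i`.
On its left boundary, edge `j` of the input polyline is reachable from parameter `B j` on (not at
all if `1 < B j`). The first component of the value at `j` is the least parameter on the link at
which vertex `p j` can be reached through the column (`2` if it cannot be reached), and the second
component is the edge on which a corresponding path enters the column. -/
noncomputable def sweep (B : ℕ → ℝ) (c i : ℕ) : ℕ → ℝ × ℕ
  | 0 => (2, 0)
  | j + 1 =>
      (firstHit ε (if 1 < B j then (sweep B c i j).1 else 0) (p (j + 1)) (p c) (p i),
        if 1 < B j then (sweep B c i j).2 else j)

/-- The least parameter on edge `j` of the input polyline that can be reached at the end of the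
link from `p c` to `p i`, and `2` if there is none. -/
noncomputable def exitParam (B : ℕ → ℝ) (c i j : ℕ) : ℝ :=
  firstHit ε (if 1 < (sweep ε p B c i j).1 then B j else 0) (p i) (p j) (p (j + 1))

/-- The edge on which a path that ends at `exitParam` enters the column. -/
noncomputable def exitSource (B : ℕ → ℝ) (c i j : ℕ) : ℕ :=
  if 1 < (sweep ε p B c i j).1 then j else (sweep ε p B c i j).2

/-- The best of the links from the vertices `0, …, c - 1` to vertex `i`, with respect to edge `j`:
the least parameter that is reached, the first vertex of the link, and the edge on which the path
enters the column of the link. -/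
noncomputable def bestLink (B : ℕ → ℕ → ℝ) (i j : ℕ) : ℕ → ℝ × ℕ × ℕ
  | 0 => (2, 0, 0)
  | c + 1 =>
      if exitParam ε p (B c) c i j < (bestLink B i j c).1 then
        (exitParam ε p (B c) c i j, c, exitSource ε p (B c) c i j)
      else bestLink B i j c

/-- The table of the dynamic program. The first component of `table a i j` is the least `t` in
`[0, 1]` such that some polyline with `a` links that ends in vertex `i` matches the input polyline
up to the point with parameter `t` on edge `j`, and `2` if there is none. The other
components tell the predecessor `i'`, `j'`. -/
noncomputable def table : ℕ → ℕ → ℕ → ℝ × ℕ × ℕ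
  | 0, i, j => (if i = 0 ∧ j = 0 then 0 else 2, 0, 0)
  | a + 1, i, j => bestLink ε p (fun c j' => (table a c j').1) i j i

/-- The link from `p c` to `p i` matches the part of the polyline `p` from the point with parameter
`t` on edge `j` to the point with parameter `t'` on edge `j'`: the vertices between these points are
close to points of the link that occur in the same order, and the end point is close to `p i`. -/
structure LinkMatch (c i j : ℕ) (t : ℝ) (j' : ℕ) (t' : ℝ) : Prop where
  le : j ≤ j'
  le_of_eq : j = j' → t ≤ t'
  dist_end : dist (AffineMap.lineMap (p j') (p (j' + 1)) t') (p i) ≤ ε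
  exists_param : ∃ u : ℕ → ℝ,
    (∀ v, j < v → v ≤ j' →
      0 ≤ u v ∧ u v ≤ 1 ∧ dist (AffineMap.lineMap (p c) (p i) (u v)) (p v) ≤ ε) ∧
    ∀ v, j < v → v < j' → u v ≤ u (v + 1)

variable {ε p} {B : ℕ → ℝ} {c i : ℕ}

theorem sweep_nonneg (j : ℕ) : 0 ≤ (sweep ε p B c i j).1 := by
  induction j with
  | zero => simp [sweep]
  | succ j ih =>
    refine firstHit_nonneg ?_ _ _ _
    split_ifs
    exacts [ih, le_rfl]

theorem sweep_snd_le (j : ℕ) : (sweep ε p B c i j).2 ≤ j := by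
  induction j with
  | zero => simp [sweep]
  | succ j ih =>
    simp only [sweep]
    split_ifs <;> omega

theorem exitParam_nonneg (hB : ∀ j, 0 ≤ B j) (j : ℕ) : 0 ≤ exitParam ε p B c i j := by
  refine firstHit_nonneg ?_ _ _ _
  split_ifs
  exacts [hB j, le_rfl]

/-- The values of the sweep between the entering edge and the current vertex form a matching. -/
theorem sweep_spec (hε : 0 ≤ ε) {j : ℕ} (h : (sweep ε p B c i j).1 ≤ 1) :
    (sweep ε p B c i j).2 < j ∧ B (sweep ε p B c i j).2 ≤ 1 ∧
      (∀ v, (sweep ε p B c i j).2 < v → v ≤ j → (sweep ε p B c i v).1 ≤ 1 ∧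
        dist (AffineMap.lineMap (p c) (p i) (sweep ε p B c i v).1) (p v) ≤ ε) ∧
      ∀ v, (sweep ε p B c i j).2 < v → v < j →
        (sweep ε p B c i v).1 ≤ (sweep ε p B c i (v + 1)).1 := by
  induction j with
  | zero => norm_num [sweep] at h
  | succ j ih =>
    have h' := h
    simp only [sweep] at h'
    obtain ⟨h1, h2⟩ := firstHit_spec hε h'
    by_cases hB : 1 < B j
    · have e : (sweep ε p B c i (j + 1)).2 = (sweep ε p B c i j).2 := by simp [sweep, hB]
      have e1 : (sweep ε p B c i j).1 ≤ (sweep ε p B c i (j + 1)).1 := by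
        simpa [sweep, hB] using h1
      obtain ⟨i1, i2, i3, i4⟩ := ih (e1.trans h)
      rw [e]
      refine ⟨by omega, i2, fun v hv hvj => ?_, fun v hv hvj => ?_⟩
      · rcases Nat.lt_or_ge j v with hjv | hjv
        · obtain rfl : v = j + 1 := by omega
          exact ⟨h, h2⟩
        · exact i3 v hv hjv
      · rcases Nat.lt_or_ge v j with hjv | hjv
        · exact i4 v hv hjv
        · obtain rfl : v = j := by omega
          exact e1
    · have e : (sweep ε p B c i (j + 1)).2 = j := by simp [sweep, hB]
      rw [e]
      refine ⟨by omega, not_lt.1 hB, fun v hv hvj => ?_, fun v hv hvj => by omega⟩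
      obtain rfl : v = j + 1 := by omega
      exact ⟨h, h2⟩

theorem sweep_le (hε : 0 ≤ ε) {j j' : ℕ} {u : ℕ → ℝ} (hBj : B j ≤ 1)
    (hu : ∀ v, j < v → v ≤ j' →
      0 ≤ u v ∧ u v ≤ 1 ∧ dist (AffineMap.lineMap (p c) (p i) (u v)) (p v) ≤ ε)
    (hmono : ∀ v, j < v → v < j' → u v ≤ u (v + 1)) {v : ℕ} (hv : j < v) (hv' : v ≤ j') :
    (sweep ε p B c i v).1 ≤ u v := by
  induction v with
  | zero => omega
  | succ v ih =>
    obtain ⟨h0, h1, h2⟩ := hu (v + 1) hv hv'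
    refine firstHit_le hε ?_ h1 h2
    split_ifs with hB
    · have hjv : j < v := by
        refine lt_of_le_of_ne (by omega) ?_
        rintro rfl
        exact absurd hB (not_lt.2 hBj)
      exact (ih hjv (by omega)).trans (hmono v hjv (by omega))
    · exact h0

theorem exitParam_le (hε : 0 ≤ ε) {j j' : ℕ} {t t' : ℝ}
    (h : LinkMatch ε p c i j t j' t') (hB : B j ≤ t) (ht : t ≤ 1) (ht0' : 0 ≤ t') (ht' : t' ≤ 1) :
    exitParam ε p B c i j' ≤ t' := by
  refine firstHit_le hε ?_ ht' h.dist_end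
  obtain ⟨u, hu, hmono⟩ := h.exists_param
  split_ifs with hs
  · rcases h.le.eq_or_lt with rfl | hlt
    · exact hB.trans (h.le_of_eq rfl)
    · have := sweep_le hε (hB.trans ht) hu hmono hlt le_rfl
      exact absurd (this.trans (hu _ hlt le_rfl).2.1) (not_le.2 hs)
  · exact ht0'

theorem exitParam_spec (hε : 0 ≤ ε) {j : ℕ} (h : exitParam ε p B c i j ≤ 1) :
    B (exitSource ε p B c i j) ≤ 1 ∧
      LinkMatch ε p c i (exitSource ε p B c i j) (B (exitSource ε p B c i j)) j
        (exitParam ε p B c i j) := by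
  obtain ⟨h1, h2⟩ := firstHit_spec hε h
  change _ ≤ exitParam ε p B c i j at h1
  by_cases hs : 1 < (sweep ε p B c i j).1
  · have e : exitSource ε p B c i j = j := if_pos hs
    rw [if_pos hs] at h1
    rw [e]
    exact ⟨h1.trans h, le_rfl, fun _ => h1, h2, fun _ => 0, fun v hv hv' => by omega,
      fun v hv hv' => by omega⟩
  · have e : exitSource ε p B c i j = (sweep ε p B c i j).2 := if_neg hs
    obtain ⟨i1, i2, i3, i4⟩ := sweep_spec hε (not_lt.1 hs)
    rw [e]
    exact ⟨i2, i1.le, fun he => absurd he i1.ne, h2, fun v => (sweep ε p B c i v).1,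
      fun v hv hv' => ⟨sweep_nonneg v, i3 v hv hv'⟩, i4⟩

variable {B : ℕ → ℕ → ℝ}

theorem bestLink_nonneg (hB : ∀ c j, 0 ≤ B c j) (i j N : ℕ) : 0 ≤ (bestLink ε p B i j N).1 := by
  induction N with
  | zero => simp [bestLink]
  | succ N ih =>
    simp only [bestLink]
    split_ifs
    exacts [exitParam_nonneg (hB N) j, ih]

theorem bestLink_le {i j c N : ℕ} (h : c < N) :
    (bestLink ε p B i j N).1 ≤ exitParam ε p (B c) c i j := by
  induction N with
  | zero => omega
  | succ N ih =>
    simp only [bestLink]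
    rcases Nat.lt_succ_iff_lt_or_eq.1 h with h' | rfl
    · split_ifs with hlt
      · exact hlt.le.trans (ih h')
      · exact ih h'
    · split_ifs with hlt
      exacts [le_rfl, not_lt.1 hlt]

theorem bestLink_spec {i j N : ℕ} (h : (bestLink ε p B i j N).1 ≤ 1) :
    ∃ c < N, bestLink ε p B i j N =
      (exitParam ε p (B c) c i j, c, exitSource ε p (B c) c i j) := by
  induction N with
  | zero => norm_num [bestLink] at h
  | succ N ih =>
    simp only [bestLink] at h ⊢
    split_ifs at h ⊢ with hlt
    · exact ⟨N, N.lt_succ_self, rfl⟩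
    · obtain ⟨c, hc, e⟩ := ih h
      exact ⟨c, by omega, e⟩

theorem table_nonneg (a i j : ℕ) : 0 ≤ (table ε p a i j).1 := by
  induction a generalizing i j with
  | zero => simp only [table]; split_ifs <;> norm_num
  | succ a ih => exact bestLink_nonneg (fun c j => ih c j) i j i

theorem table_succ_le (hε : 0 ≤ ε) {a c i j j' : ℕ} {t t' : ℝ} (hc : c < i)
    (h : LinkMatch ε p c i j t j' t') (hB : (table ε p a c j).1 ≤ t) (ht : t ≤ 1) (ht0' : 0 ≤ t')
    (ht' : t' ≤ 1) : (table ε p (a + 1) i j').1 ≤ t' :=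
  (bestLink_le hc).trans (exitParam_le (B := fun j' => (table ε p a c j').1) hε h hB ht ht0' ht')

/-- A finite entry of the table records a link and a finite entry of the level before. -/
theorem table_succ_spec (hε : 0 ≤ ε) {a i j : ℕ} (h : (table ε p (a + 1) i j).1 ≤ 1) :
    (table ε p (a + 1) i j).2.1 < i ∧
    (table ε p a (table ε p (a + 1) i j).2.1 (table ε p (a + 1) i j).2.2).1 ≤ 1 ∧
    LinkMatch ε p (table ε p (a + 1) i j).2.1 i (table ε p (a + 1) i j).2.2
      (table ε p a (table ε p (a + 1) i j).2.1 (table ε p (a + 1) i j).2.2).1 j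
      (table ε p (a + 1) i j).1 := by
  obtain ⟨c, hc, e⟩ := bestLink_spec (B := fun c j' => (table ε p a c j').1) h
  change table ε p (a + 1) i j = _ at e
  rw [e] at h ⊢
  exact ⟨hc, exitParam_spec hε h⟩

theorem table_zero_spec {i j : ℕ} (h : (table ε p 0 i j).1 ≤ 1) :
    i = 0 ∧ j = 0 ∧ (table ε p 0 i j).1 = 0 := by
  simp only [table] at h ⊢
  split_ifs at h ⊢ with h0
  · exact ⟨h0.1, h0.2, rfl⟩
  · norm_num at h

end DynamicProgram

/-! ### Polylines as curves that are parametrized by the vertex numbers -/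

/-- The polyline `⟨p 0, …, p m⟩`, parametrized such that it visits `p i` at time `i`. -/
noncomputable def polyAt (m : ℕ) (p : ℕ → Plane) (x : ℝ) : Plane :=
  p 0 + ∑ i ∈ Finset.range m, (max 0 (min 1 (x - i))) • (p (i + 1) - p i)

/-- The vertices of a polyline, indexed by natural numbers; the last vertex is repeated. -/
def extendSeq {m : ℕ} (P : Fin (m + 1) → Plane) (k : ℕ) : Plane :=
  P ⟨min k m, Nat.lt_succ_of_le (min_le_right k m)⟩

theorem extendSeq_val {m : ℕ} (P : Fin (m + 1) → Plane) (k : Fin (m + 1)) :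
    extendSeq P k = P k := by
  unfold extendSeq
  congr
  exact min_eq_left (Nat.le_of_lt_succ k.2)

theorem polyline_apply {m : ℕ} (P : Fin (m + 1) → Plane) (t : unitInterval) :
    polyline P t = polyAt m (extendSeq P) (m * t) := by
  rw [polyAt, Finset.sum_range]
  change P 0 + _ = _
  refine congrArg₂ (· + ·) (extendSeq_val P 0).symm (Finset.sum_congr rfl fun i _ => ?_)
  rw [← extendSeq_val P i.succ, ← extendSeq_val P i.castSucc]
  rfl

theorem polyAt_of_mem {m : ℕ} (p : ℕ → Plane) {j : ℕ} (hj : j < m) {x : ℝ} (h1 : (j : ℝ) ≤ x)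
    (h2 : x ≤ j + 1) : polyAt m p x = AffineMap.lineMap (p j) (p (j + 1)) (x - j) := by
  have hlow : ∀ k ≤ j, p 0 + ∑ i ∈ Finset.range k,
      (max 0 (min 1 (x - i))) • (p (i + 1) - p i) = p k := by
    intro k
    induction k with
    | zero => simp
    | succ k ih =>
      intro hk
      have : (k : ℝ) + 1 ≤ j := by exact_mod_cast hk
      rw [Finset.sum_range_succ, ← add_assoc, ih (by omega), min_eq_left (by linarith),
        max_eq_right zero_le_one]
      simp
  have hmid : ∀ k, p 0 + ∑ i ∈ Finset.range (j + 1 + k),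
      (max 0 (min 1 (x - i))) • (p (i + 1) - p i) =
        AffineMap.lineMap (p j) (p (j + 1)) (x - j) := by
    intro k
    induction k with
    | zero =>
      rw [add_zero, Finset.sum_range_succ, ← add_assoc, hlow j le_rfl, min_eq_right (by linarith),
        max_eq_right (by linarith), AffineMap.lineMap_apply, vsub_eq_sub, vadd_eq_add, add_comm]
    | succ k ih =>
      rw [← add_assoc, Finset.sum_range_succ, ← add_assoc, ih, min_eq_right, max_eq_left]
      · simp
      · push_cast; linarith [(Nat.cast_nonneg k : (0 : ℝ) ≤ k)]
      · push_cast; linarith [(Nat.cast_nonneg k : (0 : ℝ) ≤ k)]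
  obtain ⟨k, rfl⟩ := Nat.exists_eq_add_of_lt hj
  rw [polyAt, ← hmid k, show j + 1 + k = j + k + 1 by omega]

theorem polyAt_add {m : ℕ} (p : ℕ → Plane) {j : ℕ} (hj : j < m) {t : ℝ} (h0 : 0 ≤ t)
    (h1 : t ≤ 1) : polyAt m p (j + t) = AffineMap.lineMap (p j) (p (j + 1)) t := by
  rw [polyAt_of_mem p hj (by linarith) (by linarith), add_sub_cancel_left]

theorem polyAt_natCast {m : ℕ} (p : ℕ → Plane) {j : ℕ} (hj : j ≤ m) : polyAt m p j = p j := by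
  rcases hj.lt_or_eq with h | rfl
  · simpa using polyAt_add p h le_rfl zero_le_one
  · rcases j with _ | j
    · simp [polyAt]
    · simpa using polyAt_add p j.lt_succ_self zero_le_one le_rfl

theorem continuous_polyAt (m : ℕ) (p : ℕ → Plane) : Continuous (polyAt m p) := by
  unfold polyAt
  fun_prop

/-! ### Monotone paths in the free space -/

/-- There is a monotone path from `(x, y)` to `(x', y')` in the free space of `f` and `g`, the set
of all pairs of parameters where the curves have distance at most `ε`. -/
def FreePath (ε : ℝ) (f g : ℝ → Plane) (x y x' y' : ℝ) : Prop :=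
  ∃ α β : unitInterval → ℝ, Continuous α ∧ Continuous β ∧ Monotone α ∧ Monotone β ∧
    α 0 = x ∧ α 1 = x' ∧ β 0 = y ∧ β 1 = y' ∧ ∀ t, dist (f (α t)) (g (β t)) ≤ ε

/-- The concatenation of two functions on `[0, 1]` the first of which ends where the second one
starts. -/
noncomputable def glue (α α' : unitInterval → ℝ) (t : unitInterval) : ℝ :=
  α (Set.projIcc 0 1 zero_le_one (2 * t : ℝ)) +
    (α' (Set.projIcc 0 1 zero_le_one (2 * t - 1 : ℝ)) - α' 0)

theorem continuous_glue {α α' : unitInterval → ℝ} (h : Continuous α) (h' : Continuous α') :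
    Continuous (glue α α') := by
  have := continuous_projIcc (a := (0 : ℝ)) (b := 1) (h := zero_le_one)
  unfold glue
  fun_prop

theorem monotone_glue {α α' : unitInterval → ℝ} (h : Monotone α) (h' : Monotone α') :
    Monotone (glue α α') := by
  intro s t hst
  have hst' : (s : ℝ) ≤ t := hst
  exact add_le_add (h (Set.monotone_projIcc _ (by linarith)))
    (sub_le_sub_right (h' (Set.monotone_projIcc _ (by linarith))) _)

theorem glue_of_le {α α' : unitInterval → ℝ} {t : unitInterval} (ht : (t : ℝ) ≤ 1 / 2) :
    glue α α' t = α (Set.projIcc 0 1 zero_le_one (2 * t : ℝ)) := by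
  rw [glue, Set.projIcc_of_le_left zero_le_one (x := 2 * (t : ℝ) - 1) (by linarith)]
  exact add_eq_left.2 (sub_self _)

theorem glue_of_ge {α α' : unitInterval → ℝ} (h : α 1 = α' 0) {t : unitInterval}
    (ht : 1 / 2 ≤ (t : ℝ)) :
    glue α α' t = α' (Set.projIcc 0 1 zero_le_one (2 * t - 1 : ℝ)) := by
  rw [glue, Set.projIcc_of_right_le zero_le_one (x := 2 * (t : ℝ)) (by linarith)]
  change α 1 + _ = _
  rw [h]
  ring

theorem FreePath.trans {ε : ℝ} {f g : ℝ → Plane} {x y x' y' x'' y'' : ℝ}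
    (h : FreePath ε f g x y x' y') (h' : FreePath ε f g x' y' x'' y'') :
    FreePath ε f g x y x'' y'' := by
  obtain ⟨α, β, hα, hβ, mα, mβ, rfl, hα1, rfl, hβ1, hd⟩ := h
  obtain ⟨α', β', hα', hβ', mα', mβ', hα0', rfl, hβ0', rfl, hd'⟩ := h'
  have eα : α 1 = α' 0 := hα1.trans hα0'.symm
  have eβ : β 1 = β' 0 := hβ1.trans hβ0'.symm
  have half : ((0 : unitInterval) : ℝ) ≤ 1 / 2 := by norm_num
  have half' : 1 / 2 ≤ ((1 : unitInterval) : ℝ) := by norm_num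
  have p0 : Set.projIcc (0 : ℝ) 1 zero_le_one (2 * ((0 : unitInterval) : ℝ)) = 0 :=
    Set.projIcc_of_le_left _ (by norm_num)
  have p1 : Set.projIcc (0 : ℝ) 1 zero_le_one (2 * ((1 : unitInterval) : ℝ) - 1) = 1 :=
    Set.projIcc_of_right_le _ (by norm_num)
  refine ⟨glue α α', glue β β', continuous_glue hα hα', continuous_glue hβ hβ',
    monotone_glue mα mα', monotone_glue mβ mβ', ?_, ?_, ?_, ?_, fun t => ?_⟩
  · rw [glue_of_le half, p0]
  · rw [glue_of_ge eα half', p1]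
  · rw [glue_of_le half, p0]
  · rw [glue_of_ge eβ half', p1]
  · rcases le_total (t : ℝ) (1 / 2) with ht | ht
    · rw [glue_of_le ht, glue_of_le ht]
      exact hd _
    · rw [glue_of_ge eα ht, glue_of_ge eβ ht]
      exact hd' _

theorem FreePath.refl {ε : ℝ} {f g : ℝ → Plane} {x y : ℝ} (h : dist (f x) (g y) ≤ ε) :
    FreePath ε f g x y x y :=
  ⟨fun _ => x, fun _ => y, continuous_const, continuous_const, monotone_const, monotone_const,
    rfl, rfl, rfl, rfl, fun _ => h⟩

theorem dist_lineMap_lineMap_le {ε t : ℝ} (h0 : 0 ≤ t) (h1 : t ≤ 1) {u v u' v' : Plane}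
    (h : dist u u' ≤ ε) (h' : dist v v' ≤ ε) :
    dist (AffineMap.lineMap u v t) (AffineMap.lineMap u' v' t) ≤ ε := by
  rw [dist_eq_norm] at *
  have e : AffineMap.lineMap u v t - AffineMap.lineMap u' v' t =
      (1 - t) • (u - u') + t • (v - v') := by
    simp only [AffineMap.lineMap_apply_module]
    module
  rw [e]
  refine (norm_add_le _ _).trans ?_
  rw [norm_smul, norm_smul, Real.norm_of_nonneg h0, Real.norm_of_nonneg (sub_nonneg.2 h1)]
  nlinarith

theorem lineMap_add_mul (u v : Plane) (a b t : ℝ) :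
    AffineMap.lineMap u v (a + t * (b - a)) =
      AffineMap.lineMap (AffineMap.lineMap u v a) (AffineMap.lineMap u v b : Plane) t := by
  simp only [AffineMap.lineMap_apply_module]
  module

/-- The free space is convex within a cell, the product of two edges. -/
theorem FreePath.cell {ε : ℝ} {l m : ℕ} {q p : ℕ → Plane} {a b : ℕ} (ha : a < l) (hb : b < m)
    {x x' y y' : ℝ} (hx0 : 0 ≤ x) (hx : x ≤ x') (hx1 : x' ≤ 1) (hy0 : 0 ≤ y) (hy : y ≤ y')
    (hy1 : y' ≤ 1)
    (h : dist (AffineMap.lineMap (q a) (q (a + 1)) x) (AffineMap.lineMap (p b) (p (b + 1)) y) ≤ ε)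
    (h' : dist (AffineMap.lineMap (q a) (q (a + 1)) x')
      (AffineMap.lineMap (p b) (p (b + 1)) y') ≤ ε) :
    FreePath ε (polyAt l q) (polyAt m p) (a + x) (b + y) (a + x') (b + y') := by
  refine ⟨fun t => a + (x + t * (x' - x)), fun t => b + (y + t * (y' - y)), by fun_prop,
    by fun_prop, fun s t hst => ?_, fun s t hst => ?_, by simp, by simp, by simp, by simp,
    fun t => ?_⟩
  · have : (s : ℝ) ≤ t := hst
    nlinarith
  · have : (s : ℝ) ≤ t := hst
    nlinarith
  · have t0 : 0 ≤ (t : ℝ) := t.2.1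
    have t1 : (t : ℝ) ≤ 1 := t.2.2
    simp only
    rw [polyAt_add q ha (by nlinarith) (by nlinarith),
      polyAt_add p hb (by nlinarith) (by nlinarith),
      lineMap_add_mul, lineMap_add_mul]
    exact dist_lineMap_lineMap_le t0 t1 h h'

instance : Inhabited Reparam := ⟨⟨ContinuousMap.id _, monotone_id, rfl, rfl⟩⟩

theorem frechetDist_le {f g : C(unitInterval, Plane)} (r : Reparam × Reparam) :
    frechetDist f g ≤ dist (f.comp r.1.1) (g.comp r.2.1) :=
  ciInf_le ⟨0, by rintro _ ⟨r, rfl⟩; exact dist_nonneg⟩ r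

/-- A reparametrization from a monotone path coordinate. -/
theorem exists_reparam {N : ℝ} (hN : 0 < N) {α : unitInterval → ℝ} (hα : Continuous α)
    (mα : Monotone α) (h0 : α 0 = 0) (h1 : α 1 = N) :
    ∃ r : Reparam, ∀ t, N * (r.1 t : ℝ) = α t := by
  have l0 : ∀ t, 0 ≤ α t := fun t => h0 ▸ mα t.2.1
  have l1 : ∀ t, α t ≤ N := fun t => h1 ▸ mα t.2.2
  refine ⟨⟨⟨fun t => ⟨α t / N, div_nonneg (l0 t) hN.le, (div_le_one hN).2 (l1 t)⟩, by fun_prop⟩,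
    fun s t hst => ?_, ?_, ?_⟩, fun t => ?_⟩
  · exact div_le_div_of_nonneg_right (mα hst) hN.le
  · ext; simp [h0]
  · ext; simp [h1, hN.ne']
  · simp only [ContinuousMap.coe_mk]
    field_simp

theorem FreePath.frechetDist_le {ε : ℝ} {l m : ℕ} (hl : 0 < l) (hm : 0 < m)
    {Q : Fin (l + 1) → Plane} {P : Fin (m + 1) → Plane}
    (h : FreePath ε (polyAt l (extendSeq Q)) (polyAt m (extendSeq P)) 0 0 l m) :
    frechetDist (polyline Q) (polyline P) ≤ ε := by
  obtain ⟨α, β, hα, hβ, mα, mβ, hα0, hα1, hβ0, hβ1, hd⟩ := h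
  obtain ⟨r, hr⟩ := exists_reparam (Nat.cast_pos.2 hl) hα mα hα0 hα1
  obtain ⟨r', hr'⟩ := exists_reparam (Nat.cast_pos.2 hm) hβ mβ hβ0 hβ1
  refine (_root_.frechetDist_le (r, r')).trans
    ((ContinuousMap.dist_le (dist_nonneg.trans (hd 0))).2 fun t => ?_)
  simp only [ContinuousMap.comp_apply, polyline_apply, hr, hr']
  exact hd t

/-- The path in the free space that belongs to a matched link. -/
theorem LinkMatch.freePath {ε : ℝ} {l m : ℕ} {q p : ℕ → Plane} {a c i j j' : ℕ} {t t' : ℝ}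
    (h : LinkMatch ε p c i j t j' t') (ha : a < l) (hj : j' < m) (hq : q a = p c)
    (hq' : q (a + 1) = p i) (ht0 : 0 ≤ t) (ht1 : t ≤ 1) (ht0' : 0 ≤ t') (ht1' : t' ≤ 1)
    (hd : dist (AffineMap.lineMap (p j) (p (j + 1)) t) (p c) ≤ ε) :
    FreePath ε (polyAt l q) (polyAt m p) a (j + t) (a + 1 : ℕ) (j' + t') := by
  obtain ⟨u, hu, hmono⟩ := h.exists_param
  have hd' := h.dist_end
  rw [dist_comm] at hd hd'
  rw [← add_zero (a : ℝ), Nat.cast_succ]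
  have start : dist (AffineMap.lineMap (q a) (q (a + 1)) (0 : ℝ) : Plane)
      (AffineMap.lineMap (p j) (p (j + 1)) t) ≤ ε := by simpa [hq] using hd
  have finish : dist (AffineMap.lineMap (q a) (q (a + 1)) (1 : ℝ) : Plane)
      (AffineMap.lineMap (p j') (p (j' + 1)) t') ≤ ε := by simpa [hq'] using hd'
  rw [← hq, ← hq'] at hu
  rcases h.le.eq_or_lt with rfl | hlt
  · exact FreePath.cell ha hj le_rfl zero_le_one le_rfl ht0 (h.le_of_eq rfl) ht1' start finish
  · have main : ∀ v, j < v → v ≤ j' →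
        FreePath ε (polyAt l q) (polyAt m p) (a + 0) (j + t) (a + u v) v := by
      intro v
      induction v with
      | zero => intro h; omega
      | succ v ih =>
        intro hv hv'
        obtain ⟨u0, u1, ud⟩ := hu (v + 1) hv hv'
        have ud' : dist (AffineMap.lineMap (q a) (q (a + 1)) (u (v + 1)) : Plane)
          (AffineMap.lineMap (p v) (p (v + 1)) (1 : ℝ)) ≤ ε := by simpa using ud
        rcases (Nat.lt_succ_iff_lt_or_eq.1 hv) with hv2 | rfl
        · obtain ⟨w0, w1, wd⟩ := hu v hv2 (by omega)
          refine (ih hv2 (by omega)).trans ?_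
          have := FreePath.cell (b := v) ha (by omega) w0 (hmono v hv2 (by omega)) u1 le_rfl
            zero_le_one le_rfl (m := m) (by simpa using wd) ud'
          simpa using this
        · have := FreePath.cell (b := j) ha (by omega) le_rfl u0 u1 ht0 ht1 le_rfl (m := m)
            start ud'
          simpa using this
    obtain ⟨u0, u1, ud⟩ := hu j' hlt le_rfl
    refine (main j' hlt le_rfl).trans ?_
    have := FreePath.cell (b := j') ha hj u0 u1 le_rfl le_rfl ht0' ht1' (by simpa using ud) finish
    simpa using this

/-! ### A matching from the Fréchet distance -/

/-- A matching of two polylines with `l` and `m` edges: vertex `a` of the first one is matched to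
the point at time `s a` of the second one, and vertex `v` of the second one to the point at time
`u v` of the first one. The last condition says that the pairs `(a, s a)` and `(u v, v)` together
form a chain. Only non-strict inequalities occur, so that the set of matchings is compact. -/
structure IsMatching {l m : ℕ} (s : Fin (l + 1) → ℝ) (u : Fin (m + 1) → ℝ) : Prop where
  monotone_left : Monotone s
  monotone_right : Monotone u
  left_zero : s 0 = 0
  left_last : s (Fin.last l) = m
  right_nonneg : ∀ v, 0 ≤ u v
  right_le : ∀ v, u v ≤ l
  chain : ∀ (a : Fin (l + 1)) (v : Fin (m + 1)),
    (s a ≤ (v : ℕ) ∧ (a : ℕ) ≤ u v) ∨ ((v : ℕ) ≤ s a ∧ u v ≤ (a : ℕ))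

theorem isCompact_isMatching (l m : ℕ) :
    IsCompact {x : (Fin (l + 1) → ℝ) × (Fin (m + 1) → ℝ) | IsMatching x.1 x.2} := by
  have hbox : IsCompact (Set.Icc
      ((fun _ => 0, fun _ => 0) : (Fin (l + 1) → ℝ) × (Fin (m + 1) → ℝ))
      (fun _ => (m : ℝ), fun _ => (l : ℝ))) := isCompact_Icc
  refine hbox.of_isClosed_subset ?_ ?_
  · have e : {x : (Fin (l + 1) → ℝ) × (Fin (m + 1) → ℝ) | IsMatching x.1 x.2} =
        {x | (∀ a b, a ≤ b → x.1 a ≤ x.1 b) ∧ (∀ a b, a ≤ b → x.2 a ≤ x.2 b) ∧ x.1 0 = 0 ∧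
          x.1 (Fin.last l) = (m : ℝ) ∧ (∀ v, 0 ≤ x.2 v) ∧ (∀ v, x.2 v ≤ (l : ℝ)) ∧
          ∀ (a : Fin (l + 1)) (v : Fin (m + 1)),
            (x.1 a ≤ ((v : ℕ) : ℝ) ∧ ((a : ℕ) : ℝ) ≤ x.2 v) ∨
              (((v : ℕ) : ℝ) ≤ x.1 a ∧ x.2 v ≤ ((a : ℕ) : ℝ))} := by
      ext x
      exact ⟨fun h => ⟨h.1, h.2, h.3, h.4, h.5, h.6, h.7⟩,
        fun ⟨h1, h2, h3, h4, h5, h6, h7⟩ => ⟨h1, h2, h3, h4, h5, h6, h7⟩⟩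
    have c1 : ∀ a : Fin (l + 1),
        Continuous fun x : (Fin (l + 1) → ℝ) × (Fin (m + 1) → ℝ) => x.1 a := by fun_prop
    have c2 : ∀ v : Fin (m + 1),
        Continuous fun x : (Fin (l + 1) → ℝ) × (Fin (m + 1) → ℝ) => x.2 v := by fun_prop
    rw [e]
    simp only [Set.ofPred_and, Set.ofPred_forall, Set.ofPred_or]
    refine IsClosed.inter ?_ (IsClosed.inter ?_ (IsClosed.inter ?_ (IsClosed.inter ?_
      (IsClosed.inter ?_ (IsClosed.inter ?_ ?_)))))
    · exact isClosed_iInter fun a => isClosed_iInter fun b => isClosed_iInter fun _ =>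
        isClosed_le (c1 a) (c1 b)
    · exact isClosed_iInter fun a => isClosed_iInter fun b => isClosed_iInter fun _ =>
        isClosed_le (c2 a) (c2 b)
    · exact isClosed_eq (c1 _) continuous_const
    · exact isClosed_eq (c1 _) continuous_const
    · exact isClosed_iInter fun v => isClosed_le continuous_const (c2 v)
    · exact isClosed_iInter fun v => isClosed_le (c2 v) continuous_const
    · exact isClosed_iInter fun a => isClosed_iInter fun v =>
        ((isClosed_le (c1 a) continuous_const).inter (isClosed_le continuous_const (c2 v))).union
          ((isClosed_le continuous_const (c1 a)).inter (isClosed_le (c2 v) continuous_const))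
  · intro x hx
    refine ⟨⟨fun a => ?_, hx.right_nonneg⟩, fun a => ?_, hx.right_le⟩
    · exact hx.left_zero.symm.le.trans (hx.monotone_left (Fin.zero_le a))
    · exact (hx.monotone_left (Fin.le_last a)).trans hx.left_last.le

theorem IsCompact.exists_forall_le_of_forall_pos {X ι : Type*} [TopologicalSpace X] {K : Set X}
    (hK : IsCompact K) {f : ι → X → ℝ} (hf : ∀ i, Continuous (f i)) {ε : ℝ}
    (h : ∀ δ > 0, ∃ x ∈ K, ∀ i, f i x ≤ ε + δ) : ∃ x ∈ K, ∀ i, f i x ≤ ε := by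
  have key := hK.inter_iInter_nonempty (fun δ : {δ : ℝ // 0 < δ} => {x | ∀ i, f i x ≤ ε + δ})
    (fun δ => by
      simp only [Set.ofPred_forall]
      exact isClosed_iInter fun i => isClosed_le (hf i) continuous_const)
    (fun D => by
      rcases D.eq_empty_or_nonempty with rfl | hD
      · obtain ⟨x, hx, -⟩ := h 1 one_pos
        exact ⟨x, hx, by simp⟩
      · obtain ⟨x, hx, hi⟩ := h (D.min' hD) (D.min' hD).2
        refine ⟨x, hx, Set.mem_iInter₂.2 fun δ hδ i => (hi i).trans ?_⟩
        have : ((D.min' hD : {δ : ℝ // 0 < δ}) : ℝ) ≤ δ := D.min'_le δ hδ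
        linarith)
  obtain ⟨x, hx, hx'⟩ := key
  refine ⟨x, hx, fun i => le_of_forall_pos_le_add fun δ hδ => ?_⟩
  exact Set.mem_iInter.1 hx' ⟨δ, hδ⟩ i

/-- The times at which a reparametrization reaches the vertices of a polyline with `l` edges; the
end points are reached at the end points of the time interval. -/
theorem Reparam.exists_times (r : Reparam) {l : ℕ} (hl : 0 < l) :
    ∃ τ : Fin (l + 1) → unitInterval, (∀ a, (l : ℝ) * (r.1 (τ a) : ℝ) = (a : ℕ)) ∧ τ 0 = 0 ∧
      τ (Fin.last l) = 1 ∧ Monotone τ := by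
  obtain ⟨α, mα, h0, h1⟩ := r
  have hl' : (0 : ℝ) < l := Nat.cast_pos.2 hl
  have ex : ∀ a : Fin (l + 1), ∃ t, (l : ℝ) * (α t : ℝ) = (a : ℕ) ∧ (a = 0 → t = 0) ∧
      (a = Fin.last l → t = 1) := by
    intro a
    by_cases ha : a = 0
    · refine ⟨0, by simp [h0, ha], fun _ => rfl, fun h => ?_⟩
      have := congrArg Fin.val (ha.symm.trans h)
      simp at this
      omega
    · by_cases ha' : a = Fin.last l
      · exact ⟨1, by simp [h1, ha'], fun h => absurd h ha, fun _ => rfl⟩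
      · have hal : ((a : ℕ) : ℝ) ≤ l := Nat.cast_le.2 (Nat.le_of_lt_succ a.2)
        obtain ⟨t, ht⟩ : ∃ t, α t = ⟨(a : ℕ) / l, by positivity, (div_le_one hl').2 hal⟩ := by
          have := intermediate_value_univ (0 : unitInterval) 1 α.continuous
          rw [h0, h1] at this
          exact this ⟨unitInterval.nonneg', unitInterval.le_one'⟩
        refine ⟨t, ?_, fun h => absurd h ha, fun h => absurd h ha'⟩
        rw [ht]
        simp only
        field_simp
  choose τ hτ hτ0 hτ1 using ex
  refine ⟨τ, hτ, hτ0 0 rfl, hτ1 _ rfl, fun a b hab => ?_⟩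
  rcases hab.eq_or_lt with rfl | hlt
  · exact le_rfl
  · by_contra hn
    have h2 : (α (τ b) : ℝ) ≤ α (τ a) := mα (not_le.1 hn).le
    have h3 : ((a : ℕ) : ℝ) < (b : ℕ) := Nat.cast_lt.2 hlt
    rw [← hτ a, ← hτ b] at h3
    nlinarith

theorem exists_isMatching {l m : ℕ} (hl : 0 < l) (hm : 0 < m) {Q : Fin (l + 1) → Plane}
    {P : Fin (m + 1) → Plane} {ε : ℝ} (h : frechetDist (polyline Q) (polyline P) ≤ ε) :
    ∃ (s : Fin (l + 1) → ℝ) (u : Fin (m + 1) → ℝ), IsMatching s u ∧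
      (∀ a, dist (Q a) (polyAt m (extendSeq P) (s a)) ≤ ε) ∧
      ∀ v, dist (polyAt l (extendSeq Q) (u v)) (P v) ≤ ε := by
  have hl' : (0 : ℝ) < l := Nat.cast_pos.2 hl
  have hm' : (0 : ℝ) < m := Nat.cast_pos.2 hm
  let f : Fin (l + 1) ⊕ Fin (m + 1) → (Fin (l + 1) → ℝ) × (Fin (m + 1) → ℝ) → ℝ := fun i x =>
    Sum.elim (fun a => dist (Q a) (polyAt m (extendSeq P) (x.1 a)))
      (fun v => dist (polyAt l (extendSeq Q) (x.2 v)) (P v)) i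
  obtain ⟨x, hx, hd⟩ := (isCompact_isMatching l m).exists_forall_le_of_forall_pos (f := f) (ε := ε)
    (by
      have := continuous_polyAt m (extendSeq P)
      have := continuous_polyAt l (extendSeq Q)
      rintro (a | v) <;> simp only [f, Sum.elim_inl, Sum.elim_inr] <;> fun_prop)
    (fun δ hδ => by
      obtain ⟨⟨r, r'⟩, hr⟩ := exists_lt_of_ciInf_lt (lt_of_le_of_lt h (lt_add_of_pos_right ε hδ))
      have hr : ∀ t, dist (polyAt l (extendSeq Q) (l * r.1 t)) (polyAt m (extendSeq P) (m * r'.1 t))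
          ≤ ε + δ := fun t => by
        rw [← polyline_apply, ← polyline_apply]
        exact (ContinuousMap.dist_apply_le_dist t).trans hr.le
      obtain ⟨τ, hτ, hτ0, hτ1, mτ⟩ := r.exists_times hl
      obtain ⟨τ', hτ', hτ0', hτ1', mτ'⟩ := r'.exists_times hm
      have mr : ∀ t t', t ≤ t' → (r.1 t : ℝ) ≤ r.1 t' := fun t t' htt => r.2.1 htt
      have mr' : ∀ t t', t ≤ t' → (r'.1 t : ℝ) ≤ r'.1 t' := fun t t' htt => r'.2.1 htt
      refine ⟨(fun a => m * r'.1 (τ a), fun v => l * r.1 (τ' v)), ⟨?_, ?_, ?_, ?_, ?_, ?_, ?_⟩, ?_⟩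
      · exact fun a b hab => mul_le_mul_of_nonneg_left (mr' _ _ (mτ hab)) hm'.le
      · exact fun a b hab => mul_le_mul_of_nonneg_left (mr _ _ (mτ' hab)) hl'.le
      · simp [hτ0, r'.2.2.1]
      · simp [hτ1, r'.2.2.2]
      · exact fun v => mul_nonneg hl'.le (r.1 (τ' v)).2.1
      · exact fun v => mul_le_of_le_one_right hl'.le (r.1 (τ' v)).2.2
      · intro a v
        rw [← hτ, ← hτ']
        rcases le_total (τ a) (τ' v) with hle | hle
        · exact Or.inl ⟨mul_le_mul_of_nonneg_left (mr' _ _ hle) hm'.le,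
            mul_le_mul_of_nonneg_left (mr _ _ hle) hl'.le⟩
        · exact Or.inr ⟨mul_le_mul_of_nonneg_left (mr' _ _ hle) hm'.le,
            mul_le_mul_of_nonneg_left (mr _ _ hle) hl'.le⟩
      · rintro (a | v)
        · have := hr (τ a)
          rwa [hτ, polyAt_natCast _ (Nat.le_of_lt_succ a.2), extendSeq_val] at this
        · have := hr (τ' v)
          rwa [hτ', polyAt_natCast _ (Nat.le_of_lt_succ v.2), extendSeq_val] at this)
  exact ⟨x.1, x.2, hx, fun a => hd (Sum.inl a), fun v => hd (Sum.inr v)⟩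

/-! ### Correctness of the dynamic program -/

theorem exists_edge {m j : ℕ} {x y : ℝ} (hj : j < m) (hx0 : (j : ℝ) ≤ x)
    (hxy : x ≤ y) (hy : y ≤ m) : ∃ j', j ≤ j' ∧ j' < m ∧ (j' : ℝ) ≤ y ∧ y ≤ j' + 1 := by
  by_cases h : y ≤ j + 1
  · exact ⟨j, le_rfl, hj, hx0.trans hxy, h⟩
  · have hy0 : 0 ≤ y := (Nat.cast_nonneg j).trans (hx0.trans hxy)
    have hc : j + 1 < ⌈y⌉₊ := Nat.lt_ceil.2 (by push_cast; linarith)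
    have hm : ⌈y⌉₊ ≤ m := Nat.ceil_le.2 hy
    have e : ((⌈y⌉₊ - 1 : ℕ) : ℝ) = (⌈y⌉₊ : ℝ) - 1 := by push_cast [show 1 ≤ ⌈y⌉₊ by omega]; ring
    refine ⟨⌈y⌉₊ - 1, by omega, by omega, ?_, ?_⟩
    · rw [e]; linarith [Nat.ceil_lt_add_one hy0]
    · rw [e]; linarith [Nat.le_ceil y]

theorem le_table_of_isMatching {l m : ℕ} {P : Fin (m + 1) → Plane} {σ : Fin (l + 1) → Fin (m + 1)}
    {ε : ℝ} (hε : 0 ≤ ε) (hm : 0 < m) (hσ : IsSimplification P ε σ) {s : Fin (l + 1) → ℝ}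
    {u : Fin (m + 1) → ℝ} (hM : IsMatching s u)
    (hs : ∀ a, dist ((P ∘ σ) a) (polyAt m (extendSeq P) (s a)) ≤ ε)
    (hu : ∀ v, dist (polyAt l (extendSeq (P ∘ σ)) (u v)) (P v) ≤ ε) (a : ℕ) (ha : a < l + 1) :
    ∃ j < m, (j : ℝ) ≤ s ⟨a, ha⟩ ∧ s ⟨a, ha⟩ ≤ j + 1 ∧
      (table ε (extendSeq P) a (σ ⟨a, ha⟩) j).1 ≤ s ⟨a, ha⟩ - j := by
  induction a with
  | zero =>
    have e : s ⟨0, ha⟩ = 0 := hM.left_zero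
    have e' : σ ⟨0, ha⟩ = 0 := hσ.first
    refine ⟨0, hm, ?_⟩
    rw [e, e']
    simp [table]
  | succ a ih =>
    have ha0 : a < l + 1 := by omega
    have hal : a < l := by omega
    obtain ⟨j, hj, hj0, hj1, ht⟩ := ih ha0
    have hle : s ⟨a, ha0⟩ ≤ s ⟨a + 1, ha⟩ := hM.monotone_left (Fin.mk_le_mk.2 a.le_succ)
    have hsm : s ⟨a + 1, ha⟩ ≤ m := (hM.monotone_left (Fin.le_last _)).trans hM.left_last.le
    obtain ⟨j', hjj', hj', hj0', hj1'⟩ := exists_edge hj hj0 hle hsm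
    refine ⟨j', hj', hj0', hj1', table_succ_le hε (c := σ ⟨a, ha0⟩) (j := j)
      (t := s ⟨a, ha0⟩ - j) (hσ.strictMono (Fin.mk_lt_mk.2 a.lt_succ_self)) ?_ ht (by linarith)
      (by linarith) (by linarith)⟩
    -- The parameters of the vertices on the link are clamped to `[0, 1]`: a vertex that is matched
    -- to a point beyond the link coincides with the point that is matched to an end of the link.
    let w : ℕ → ℝ := fun v =>
      max 0 (min 1 (u ⟨min v m, Nat.lt_succ_of_le (min_le_right v m)⟩ - a))
    have qa : extendSeq (P ∘ σ) a = extendSeq P (σ ⟨a, ha0⟩) := by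
      rw [extendSeq_val]; exact extendSeq_val (P ∘ σ) ⟨a, ha0⟩
    have qa' : extendSeq (P ∘ σ) (a + 1) = extendSeq P (σ ⟨a + 1, ha⟩) := by
      rw [extendSeq_val]; exact extendSeq_val (P ∘ σ) ⟨a + 1, ha⟩
    refine ⟨hjj', fun h => by subst h; linarith, ?_, w, fun v hv hv' => ⟨le_max_left _ _, ?_, ?_⟩,
      fun v hv hv' => ?_⟩
    · rw [← polyAt_of_mem _ hj' hj0' hj1', extendSeq_val, dist_comm]
      exact hs _
    · exact max_le zero_le_one (min_le_left _ _)
    · have hvm : v < m + 1 := by omega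
      have hvv : extendSeq P v = P ⟨v, hvm⟩ := extendSeq_val P ⟨v, hvm⟩
      have ew : w v = max 0 (min 1 (u ⟨v, hvm⟩ - a)) := by
        simp only [w, min_eq_left (Nat.le_of_lt_succ hvm)]
      have hv1 : (j : ℝ) + 1 ≤ v := by exact_mod_cast hv
      have hv2 : (v : ℝ) ≤ j' := Nat.cast_le.2 hv'
      have huv := hu ⟨v, hvm⟩
      rw [hvv, ew, ← qa, ← qa']
      rcases lt_or_ge (u ⟨v, hvm⟩) a with h1 | h1
      · rw [min_eq_right (by linarith), max_eq_left (by linarith), AffineMap.lineMap_apply_zero, qa,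
          extendSeq_val]
        rcases hM.chain ⟨a, ha0⟩ ⟨v, hvm⟩ with h2 | h2
        · exact absurd h1 (not_lt.2 h2.2)
        · have e : s ⟨a, ha0⟩ = v := le_antisymm (by linarith) h2.1
          have := hs ⟨a, ha0⟩
          rwa [e, polyAt_natCast _ (Nat.le_of_lt_succ hvm), hvv] at this
      · rcases le_or_gt (u ⟨v, hvm⟩) (a + 1) with h2 | h2
        · rw [min_eq_right (by linarith), max_eq_right (by linarith),
            ← polyAt_of_mem _ hal h1 h2]
          exact huv
        · rw [min_eq_left (by linarith), max_eq_right zero_le_one, AffineMap.lineMap_apply_one, qa',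
            extendSeq_val]
          rcases hM.chain ⟨a + 1, ha⟩ ⟨v, hvm⟩ with h3 | h3
          · have e : s ⟨a + 1, ha⟩ = v := le_antisymm h3.1 (by linarith)
            have := hs ⟨a + 1, ha⟩
            rwa [e, polyAt_natCast _ (Nat.le_of_lt_succ hvm), hvv] at this
          · have := h3.2
            push_cast at this
            linarith
    · refine max_le_max le_rfl (min_le_min le_rfl (sub_le_sub_right (hM.monotone_right ?_) _))
      exact Fin.mk_le_mk.2 (min_le_min (Nat.le_succ v) le_rfl)

theorem IsSimplification.table_le_one {l m : ℕ} {P : Fin (m + 1) → Plane}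
    {σ : Fin (l + 1) → Fin (m + 1)} {ε : ℝ} (hε : 0 ≤ ε) (hm : 0 < m)
    (hσ : IsSimplification P ε σ) : (table ε (extendSeq P) l m (m - 1)).1 ≤ 1 := by
  have hl : 0 < l := by
    rcases Nat.eq_zero_or_pos l with rfl | h
    · have := congrArg Fin.val (hσ.first.symm.trans hσ.last)
      simp at this
      omega
    · exact h
  obtain ⟨s, u, hM, hs, hu⟩ := exists_isMatching hl hm hσ.dist_le
  obtain ⟨j, hj, h0, h1, h⟩ := le_table_of_isMatching hε hm hσ hM hs hu l l.lt_succ_self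
  have e : s ⟨l, l.lt_succ_self⟩ = m := hM.left_last
  have e' : σ ⟨l, l.lt_succ_self⟩ = Fin.last m := hσ.last
  rw [e] at h0 h1 h
  rw [e'] at h
  have : m ≤ j + 1 := by exact_mod_cast h1
  obtain rfl : j = m - 1 := by omega
  exact h.trans (by linarith)

/-- The states of the dynamic program on the way back from the final state of level `l`: the value
at `k` is the vertex and the edge on level `l - k`. -/
noncomputable def trace (ε : ℝ) (p : ℕ → Plane) (l m : ℕ) : ℕ → ℕ × ℕ
  | 0 => (m, m - 1)
  | k + 1 => (table ε p (l - k) (trace ε p l m k).1 (trace ε p l m k).2).2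

section Trace

variable {ε : ℝ} {p : ℕ → Plane} {l m : ℕ}

theorem trace_step (hε : 0 ≤ ε) {k : ℕ} (hk : k < l)
    (h : (table ε p (l - k) (trace ε p l m k).1 (trace ε p l m k).2).1 ≤ 1) :
    (trace ε p l m (k + 1)).1 < (trace ε p l m k).1 ∧
    (table ε p (l - (k + 1)) (trace ε p l m (k + 1)).1 (trace ε p l m (k + 1)).2).1 ≤ 1 ∧
    LinkMatch ε p (trace ε p l m (k + 1)).1 (trace ε p l m k).1 (trace ε p l m (k + 1)).2
      (table ε p (l - (k + 1)) (trace ε p l m (k + 1)).1 (trace ε p l m (k + 1)).2).1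
      (trace ε p l m k).2 (table ε p (l - k) (trace ε p l m k).1 (trace ε p l m k).2).1 := by
  have e : l - k = (l - (k + 1)) + 1 := by omega
  simp only [trace]
  rw [e] at h ⊢
  exact table_succ_spec hε h

theorem trace_table_le_one (hε : 0 ≤ ε) (h : (table ε p l m (m - 1)).1 ≤ 1) {k : ℕ} (hk : k ≤ l) :
    (table ε p (l - k) (trace ε p l m k).1 (trace ε p l m k).2).1 ≤ 1 := by
  induction k with
  | zero => exact h
  | succ k ih => exact (trace_step hε (by omega) (ih (by omega))).2.1

theorem trace_le (hε : 0 ≤ ε) (h : (table ε p l m (m - 1)).1 ≤ 1) {k : ℕ} (hk : k ≤ l) :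
    (trace ε p l m k).1 ≤ m ∧ (trace ε p l m k).2 ≤ m - 1 := by
  induction k with
  | zero => simp [trace]
  | succ k ih =>
    obtain ⟨h1, -, h2⟩ := trace_step hε (by omega)
      (trace_table_le_one (m := m) hε h (k := k) (by omega))
    obtain ⟨i1, i2⟩ := ih (by omega)
    exact ⟨by omega, h2.le.trans i2⟩

theorem trace_strictAnti (hε : 0 ≤ ε) (h : (table ε p l m (m - 1)).1 ≤ 1) {k k' : ℕ} (hk : k < k')
    (hk' : k' ≤ l) : (trace ε p l m k').1 < (trace ε p l m k).1 := by
  induction k' with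
  | zero => omega
  | succ k' ih =>
    have h1 := (trace_step hε (by omega)
      (trace_table_le_one (m := m) hε h (k := k') (by omega))).1
    rcases Nat.lt_succ_iff_lt_or_eq.1 hk with h2 | rfl
    · exact h1.trans (ih h2 (by omega))
    · exact h1

theorem freePath_trace (hε : 0 ≤ ε) (hm : 0 < m) (h : (table ε p l m (m - 1)).1 ≤ 1) {q : ℕ → Plane}
    (hq : ∀ a ≤ l, q a = p (trace ε p l m (l - a)).1) {a : ℕ} (ha : a ≤ l) :
    dist (AffineMap.lineMap (p (trace ε p l m (l - a)).2) (p ((trace ε p l m (l - a)).2 + 1))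
      (table ε p a (trace ε p l m (l - a)).1 (trace ε p l m (l - a)).2).1)
      (p (trace ε p l m (l - a)).1) ≤ ε ∧
    FreePath ε (polyAt l q) (polyAt m p) 0 0 a ((trace ε p l m (l - a)).2 +
      (table ε p a (trace ε p l m (l - a)).1 (trace ε p l m (l - a)).2).1) := by
  induction a with
  | zero =>
    have h1 := trace_table_le_one hε h (le_refl l)
    rw [Nat.sub_self] at h1
    obtain ⟨h2, h3, h4⟩ := table_zero_spec h1
    have hq0 := hq 0 ha
    rw [Nat.sub_zero] at hq0 ⊢
    rw [h4, h2, h3]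
    rw [h2] at hq0
    refine ⟨by simpa using hε, ?_⟩
    simp only [Nat.cast_zero, add_zero]
    refine FreePath.refl ?_
    have e1 := polyAt_natCast (m := l) q (Nat.zero_le l)
    have e2 := polyAt_natCast (m := m) p (Nat.zero_le m)
    rw [Nat.cast_zero] at e1 e2
    rw [e1, e2, hq0, dist_self]
    exact hε
  | succ a ih =>
    obtain ⟨i1, i2⟩ := ih (by omega)
    have hk : l - (a + 1) + 1 = l - a := by omega
    have hk' : l - (l - (a + 1)) = a + 1 := by omega
    have hk'' : l - (l - a) = a := by omega
    have t1 := trace_table_le_one (m := m) hε h (k := l - (a + 1)) (by omega)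
    have t2 := trace_table_le_one (m := m) hε h (k := l - a) (by omega)
    obtain ⟨-, -, h3⟩ := trace_step hε (by omega) t1
    rw [hk'] at t1
    rw [hk''] at t2
    rw [hk, hk', hk''] at h3
    have hlt := (trace_le (m := m) hε h (k := l - (a + 1)) (by omega)).2
    refine ⟨h3.dist_end, i2.trans ?_⟩
    exact h3.freePath (by omega) (by omega) (hq a (by omega)) (hq (a + 1) ha) (table_nonneg _ _ _)
      t2 (table_nonneg _ _ _) t1 i1

end Trace

theorem isSimplification_trace {l m : ℕ} {P : Fin (m + 1) → Plane} {ε : ℝ} (hε : 0 ≤ ε)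
    (hm : 0 < m) (h : (table ε (extendSeq P) l m (m - 1)).1 ≤ 1) {σ : Fin (l + 1) → Fin (m + 1)}
    (hσ : ∀ a, (σ a : ℕ) = (trace ε (extendSeq P) l m (l - a)).1) : IsSimplification P ε σ := by
  have hl : 0 < l := by
    rcases Nat.eq_zero_or_pos l with rfl | h'
    · have := (table_zero_spec h).1
      omega
    · exact h'
  have h0 := trace_table_le_one hε h (le_refl l)
  rw [Nat.sub_self] at h0
  have hq : ∀ a ≤ l, extendSeq (P ∘ σ) a =
      extendSeq P (trace ε (extendSeq P) l m (l - a)).1 := by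
    intro a ha
    have := hσ ⟨a, Nat.lt_succ_of_le ha⟩
    rw [← this, extendSeq_val]
    exact extendSeq_val (P ∘ σ) ⟨a, Nat.lt_succ_of_le ha⟩
  refine ⟨fun a b hab => ?_, Fin.ext ?_, Fin.ext ?_, ?_⟩
  · rw [Fin.lt_def, hσ, hσ]
    have := Nat.le_of_lt_succ b.2
    exact trace_strictAnti hε h (by have := Fin.lt_def.1 hab; omega) (by omega)
  · rw [hσ]
    exact (table_zero_spec h0).1
  · rw [hσ]
    simp [trace]
  · refine FreePath.frechetDist_le hl hm ?_
    obtain ⟨h1, h2⟩ := freePath_trace hε hm h hq (le_refl l)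
    simp only [Nat.sub_self, trace] at h1 h2
    refine h2.trans ?_
    have hm1 : m - 1 + 1 = m := by omega
    have hl1 : l - 1 + 1 = l := by omega
    have ql : extendSeq (P ∘ σ) l = extendSeq P m := by
      rw [hq l le_rfl, Nat.sub_self]; rfl
    -- The rest of the last edge of `P` is matched to the last vertex of the simplification.
    have := FreePath.cell (ε := ε) (q := extendSeq (P ∘ σ)) (p := extendSeq P) (a := l - 1)
      (b := m - 1) (l := l) (m := m) (by omega) (by omega) zero_le_one (le_refl 1) le_rfl
      (table_nonneg l m (m - 1)) h le_rfl
      (by rw [hl1, AffineMap.lineMap_apply_one, ql, dist_comm]; exact h1)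
      (by rw [hl1, hm1, AffineMap.lineMap_apply_one, AffineMap.lineMap_apply_one, ql, dist_self]
          exact hε)
    rwa [← Nat.cast_succ, ← Nat.cast_succ, Nat.succ_eq_add_one, Nat.succ_eq_add_one, hl1, hm1]
      at this

theorem frechetDist_self_le {ε : ℝ} (hε : 0 ≤ ε) (f : C(unitInterval, Plane)) :
    frechetDist f f ≤ ε :=
  (frechetDist_le (default, default)).trans (by rw [dist_self]; exact hε)

theorem isSimplification_id {m : ℕ} (P : Fin (m + 1) → Plane) {ε : ℝ} (hε : 0 ≤ ε) :
    IsSimplification P ε (id : Fin (m + 1) → Fin (m + 1)) :=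
  ⟨strictMono_id, rfl, rfl, frechetDist_self_le hε _⟩

/-! ### The program -/

namespace RealRAM

/-- The address of the entry for level `a`, vertex `i` and edge `j` of the table in the real memory;
`n` is the number of vertices. The cells below `2 * n` hold the coordinates of the vertices. The
predecessor of the entry is stored in the cells `2 * adr n a i j` and `2 * adr n a i j + 1` of the
integer memory. -/
def adr (n a i j : ℕ) : ℕ := (a * n + i) * n + j + n + n

/-- Put the address of a table entry into integer register `8`. -/
def adrCode (ra ri rj : ℕ) : List Instr :=
  [.nMul 8 ra 0, .nAdd 8 8 ri, .nMul 8 8 0, .nAdd 8 8 rj, .nAdd 8 8 0, .nAdd 8 8 0]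

/-- Put the coordinates of the vertex whose number is in integer register `ri` into the real
registers `d` and `d + 1`. -/
def vertexCode (ri d : ℕ) : List Instr :=
  [.nAdd 8 ri ri, .rLoad d 8, .nAdd 8 8 2, .rLoad (d + 1) 8]

/-- Compute `firstRoot` of the real registers `6`, `14`, `15`, `16` into register `13`. -/
def rootCmd : Cmd :=
  .cond (.rLt 2 14)
    (.seq (.block [.rMul 17 15 15, .rMul 18 14 16, .rSub 17 17 18])
      (.cond (.rLt 17 2) (.block [.rCopy 13 3])
        (.seq (.block
            [.rSqrt 17 17, .rSub 13 15 17, .rDiv 13 13 14, .rAdd 18 15 17, .rDiv 18 18 14])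
          (.seq (.cond (.rLt 13 6) (.block [.rCopy 13 6]) (.block []))
            (.cond (.rLt 1 13) (.block [.rCopy 13 3])
              (.cond (.rLt 18 13) (.block [.rCopy 13 3]) (.block [])))))))
    (.cond (.rLt 2 16) (.block [.rCopy 13 3])
      (.cond (.rLt 1 6) (.block [.rCopy 13 3]) (.block [.rCopy 13 6])))

/-- The coefficients of the quadratic polynomial for `firstHit`. -/
def coeffCode : List Instr :=
  [.rSub 11 11 9, .rSub 12 12 10, .rSub 7 7 9, .rSub 8 8 10,
    .rMul 14 11 11, .rMul 17 12 12, .rAdd 14 14 17,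
    .rMul 15 7 11, .rMul 17 8 12, .rAdd 15 15 17,
    .rMul 16 7 7, .rMul 17 8 8, .rAdd 16 16 17, .rMul 17 0 0, .rSub 16 16 17]

/-- Compute `firstHit` into real register `13`; `ε` is in register `0`, the lower bound in register
`6`, and the three points are in the registers `7, …, 12`. -/
def hitCmd : Cmd := .seq (.block coeffCode) rootCmd

/-- Compute `firstHit` for the vertices whose numbers are in the integer registers `ra`, `rb`,
`rc`. -/
def vertexHitCmd (ra rb rc : ℕ) : Cmd :=
  .seq (.block (vertexCode ra 7 ++ (vertexCode rb 9 ++ (vertexCode rc 11 ++ [])))) hitCmd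

/-- One step of the sweep along the column of the link from vertex `c` (register `5`) to vertex `i`
(register `4`), at edge `j` (register `6`). Integer register `3` holds the preceding level, register
`12` the current one. Integer register `7` and real register `4` hold the state of the sweep. -/
def sweepCmd : Cmd :=
  .seq (.block (adrCode 3 5 6 ++ [.rLoad 5 8, .nAdd 14 6 2]))
  (.seq (.cond (.rLt 1 4) (.block [.rCopy 6 5, .nCopy 11 6]) (.block [.rCopy 6 2, .nCopy 11 7]))
  (.seq (vertexHitCmd 4 6 14)
  (.seq (.block (adrCode 12 4 6 ++ [.rLoad 14 8]))
  (.seq (.cond (.rLt 13 14)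
      (.block [.rStore 8 13, .nAdd 9 8 8, .nStore 9 5, .nAdd 9 9 2, .nStore 9 11]) (.block []))
  (.seq (.cond (.rLt 1 5) (.block [.rCopy 6 4]) (.block [.rCopy 6 2, .nCopy 7 6]))
  (.seq (vertexHitCmd 14 5 4)
  (.block [.rCopy 4 13, .nCopy 6 14])))))))

/-- The sweep along the column of a link, and the increment of `c`. -/
def columnCmd : Cmd :=
  .seq (.block [.nConst 6 0, .nConst 7 0, .rCopy 4 3])
  (.seq (.loop (.nLt 6 1) sweepCmd)
  (.block [.nAdd 5 5 2]))

/-- All links to vertex `i`, and the increment of `i`. -/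
def vertexCmd : Cmd :=
  .seq (.block [.nConst 5 0])
  (.seq (.loop (.nLt 5 4) columnCmd)
  (.block [.nAdd 4 4 2]))

/-- Fill the current level of the table with the value `2`. -/
def clearCmd : Cmd :=
  .seq (.block [.nConst 10 0])
  (.loop (.nLt 10 13) (.block (adrCode 12 15 10 ++ [.rStore 8 3, .nAdd 10 10 2])))

/-- Load the table entry of the current level that decides whether a simplification is found into
real register `19`. -/
def testCmd : Cmd := .block (adrCode 12 1 16 ++ [.rLoad 19 8])

/-- Compute the next level of the table. -/
def levelCmd : Cmd :=
  .seq (.block [.nCopy 3 12, .nAdd 12 12 2, .nConst 4 0])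
  (.seq clearCmd
  (.seq (.loop (.nLt 4 0) vertexCmd)
  testCmd))

/-- Go back from the final table entry to level `0` and write the vertices to the output. -/
def traceCmd : Cmd :=
  .seq (.block [.nCopy 4 1, .nCopy 6 16, .nStore 12 4, .nAdd 3 12 2])
  (.seq (.loop (.nLt 15 12)
    (.block (adrCode 12 4 6 ++
      [.nAdd 8 8 8, .nLoad 4 8, .nAdd 8 8 2, .nLoad 6 8, .nSub 12 12 2, .nStore 12 4])))
  (.block [.nCopy 0 3]))

/-- The program for at least two vertices. -/
def searchCmd : Cmd :=
  .seq (.block [.nSub 1 0 2, .nMul 13 0 0, .nSub 16 1 2, .rOfNat 1 2, .rAdd 3 1 1])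
  (.seq clearCmd
  (.seq (.block (adrCode 12 15 15 ++ [.rStore 8 2]))
  (.seq testCmd
  (.seq (.loop (.rLt 1 19) levelCmd)
  traceCmd))))

/-- The main program. A single vertex needs no computation: the output is already present.

The integer registers `0`, `1`, `2`, `13`, `15`, `16` hold the constants `n`, `m = n - 1`, `1`,
`n * n`, `0` and `m - 1`, the real registers `0`, …, `3` hold `ε`, `1`, `0` and `2`. The levels, the
vertices and the edge that are being processed are in the integer registers `3`, `12` (preceding
and current level), `4`, `5` (end and start of the link) and `6`. -/
def mainCmd : Cmd :=
  .seq (.block [.nConst 2 1]) (.cond (.nLt 2 0) searchCmd (.block []))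

/-! ### Verification of the program -/

theorem blockPost_adrCode {S : ℕ} {Q : Store → Prop} {rest : List Instr} {s : Store}
    {ra ri rj : ℕ} (hi : ri ≠ 8) (hj : rj ≠ 8) (hn : 0 < s.n 0)
    (hS : adr (s.n 0) (s.n ra) (s.n ri) (s.n rj) < S)
    (h : BlockPost S Q rest (s.setN 8 (adr (s.n 0) (s.n ra) (s.n ri) (s.n rj)))) :
    BlockPost S Q (adrCode ra ri rj ++ rest) s := by
  have h1 : s.n ra * s.n 0 + s.n ri ≤ (s.n ra * s.n 0 + s.n ri) * s.n 0 :=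
    Nat.le_mul_of_pos_right _ hn
  unfold adr at hS h
  simp only [adrCode, List.cons_append, List.nil_append, BlockPost, Store.setN_n, Store.setN_setN,
    if_pos, if_neg hi, if_neg hj, if_neg (show (0 : ℕ) ≠ 8 by decide)]
  exact ⟨by omega, by omega, by omega, by omega, by omega, by omega, h⟩

theorem blockPost_vertexCode {S : ℕ} {Q : Store → Prop} {rest : List Instr} {s : Store}
    {ri d k : ℕ} (hk : s.n ri = k) (h1 : s.n 2 = 1) (hS : 2 * k + 1 < S)
    (h : BlockPost S Q rest
      (((s.setN 8 (2 * k + 1)).setR d (s.rm (2 * k))).setR (d + 1) (s.rm (2 * k + 1)))) :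
    BlockPost S Q (vertexCode ri d ++ rest) s := by
  subst hk
  simp only [vertexCode, List.cons_append, List.nil_append, BlockPost, Store.setN_n, Store.setR_n,
    Store.setN_rm, Store.setR_rm, if_pos, if_neg (show (2 : ℕ) ≠ 8 by decide), h1, ← two_mul]
  refine ⟨by omega, by omega, by omega, by omega, ?_⟩
  convert h using 2
  simp [Store.setN, Store.setR]

/-- The effect of the subroutines for `firstHit`: they change only real registers from `7` on. -/
structure HitFrame (s s' : Store) : Prop where
  n : s'.n = s.n
  nm : s'.nm = s.nm
  rm : s'.rm = s.rm
  r : ∀ k < 7, s'.r k = s.r k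

theorem rootCmd_spec (S : ℕ) (s : Store) (h1 : s.r 1 = 1) (h2 : s.r 2 = 0) (h3 : s.r 3 = 2) :
    Wp S rootCmd 25 s fun s' => HitFrame s s' ∧
      s'.r 13 = firstRoot (s.r 6) (s.r 14) (s.r 15) (s.r 16) := by
  have frame : ∀ s' : Store, s'.n = s.n → s'.nm = s.nm → s'.rm = s.rm →
      (∀ k < 7, s'.r k = s.r k) → HitFrame s s' := fun s' a b c d => ⟨a, b, c, d⟩
  have low : ∀ k < 7, k ≠ 13 ∧ k ≠ 17 ∧ k ≠ 18 := by omega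
  refine Wp.cond (T := 23) (fun hA => ?_) (fun hA => ?_)
  · simp only [Cond.Holds, h2] at hA
    refine Wp.seq (T := 3) (U := 20) (Q := fun s' => s' = ((s.setR 17 (s.r 15 * s.r 15)).setR 18
      (s.r 14 * s.r 16)).setR 17 (s.r 15 * s.r 15 - s.r 14 * s.r 16)) (Wp.block (by decide) ?_) ?_
    · simp [BlockPost]
    rintro s' rfl
    set D := s.r 15 * s.r 15 - s.r 14 * s.r 16 with hD
    refine Wp.cond (T := 18) (fun hD0 => Wp.block (by decide) ?_) (fun hD0 => ?_)
    · simp only [Cond.Holds] at hD0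
      simp [h2] at hD0
      refine ⟨frame _ rfl rfl rfl fun k hk => ?_, ?_⟩
      · simp [low k hk]
      · simp [firstRoot, hA, ← hD, hD0, h3]
    · simp only [Cond.Holds] at hD0
      simp [h2] at hD0
      refine Wp.seq (T := 5) (U := 13) (Q := fun s' => s'.n = s.n ∧ s'.nm = s.nm ∧ s'.rm = s.rm ∧
        (∀ k < 7, s'.r k = s.r k) ∧ s'.r 13 = (s.r 15 - √D) / s.r 14 ∧
          s'.r 18 = (s.r 15 + √D) / s.r 14) (Wp.block (by decide) ?_) ?_
      · simp only [BlockPost]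
        simp [hD0, hA.ne']
        intro k hk
        simp [low k hk]
      rintro s₁ ⟨n₁, nm₁, rm₁, r₁, e13, e18⟩
      refine Wp.seq (T := 3) (U := 10) (Q := fun s' => s'.n = s.n ∧ s'.nm = s.nm ∧ s'.rm = s.rm ∧
        (∀ k < 7, s'.r k = s.r k) ∧ s'.r 13 = max (s.r 6) ((s.r 15 - √D) / s.r 14) ∧
          s'.r 18 = (s.r 15 + √D) / s.r 14)
        (Wp.cond (T := 1) (fun h => Wp.block (by decide) ?_) (fun h => Wp.block (by decide) ?_)) ?_
      · simp only [Cond.Holds, e13, r₁ 6 (by decide)] at h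
        simp only [BlockPost]
        refine ⟨n₁, nm₁, rm₁, fun k hk => ?_, ?_, ?_⟩
        · simp [low k hk, r₁ k hk]
        · simp [r₁, max_eq_left h.le]
        · simp [e18]
      · simp only [Cond.Holds, e13, r₁ 6 (by decide)] at h
        exact ⟨n₁, nm₁, rm₁, r₁, by rw [e13, max_eq_right (not_lt.1 h)], e18⟩
      rintro s₂ ⟨n₂, nm₂, rm₂, r₂, e13', e18'⟩
      have hf : firstRoot (s.r 6) (s.r 14) (s.r 15) (s.r 16) =
          if 1 < s₂.r 13 then 2 else if s₂.r 18 < s₂.r 13 then 2 else s₂.r 13 := by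
        rw [e13', e18', firstRoot, if_pos hA, if_neg (not_lt.2 hD0)]
      rw [hf]
      refine Wp.cond (T := 8) (fun h => Wp.block (by decide) ?_)
        (fun h => Wp.cond (T := 6) (fun h' => Wp.block (by decide) ?_)
          (fun h' => Wp.block (by decide) ?_))
      all_goals simp only [Cond.Holds, r₂ 1 (by decide), h1] at h
      · refine ⟨frame _ n₂ nm₂ rm₂ fun k hk => ?_, ?_⟩
        · simp [low k hk, r₂ k hk]
        · simp [h, r₂, h3]
      · refine ⟨frame _ n₂ nm₂ rm₂ fun k hk => ?_, ?_⟩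
        · simp [low k hk, r₂ k hk]
        · simp only [Cond.Holds] at h'
          simp [h', r₂, h3]
      · simp only [Cond.Holds] at h'
        refine ⟨frame _ n₂ nm₂ rm₂ r₂, ?_⟩
        rw [if_neg h, if_neg h']
  · simp only [Cond.Holds, h2] at hA
    rw [show firstRoot (s.r 6) (s.r 14) (s.r 15) (s.r 16) =
      if 0 < s.r 16 then 2 else if 1 < s.r 6 then 2 else s.r 6 by rw [firstRoot, if_neg hA]]
    refine Wp.cond (T := 21) (fun h => Wp.block (by decide) ?_)
      (fun h => Wp.cond (T := 19) (fun h' => Wp.block (by decide) ?_)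
        (fun h' => Wp.block (by decide) ?_))
    all_goals simp only [Cond.Holds, h2] at h
    all_goals
      refine ⟨frame _ rfl rfl rfl fun k hk => ?_, ?_⟩
      · simp [low k hk]
    · simp [h, h3]
    · simp only [Cond.Holds, h1] at h'
      simp [h', h3]
    · simp only [Cond.Holds, h1] at h'
      simp [h, h']

theorem hitCmd_spec (S : ℕ) (s : Store) (p q r : Plane) (h1 : s.r 1 = 1) (h2 : s.r 2 = 0)
    (h3 : s.r 3 = 2) (hp : s.r 7 = p 0) (hp' : s.r 8 = p 1) (hq : s.r 9 = q 0) (hq' : s.r 10 = q 1)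
    (hr : s.r 11 = r 0) (hr' : s.r 12 = r 1) :
    Wp S hitCmd 40 s fun s' => HitFrame s s' ∧ s'.r 13 = firstHit (s.r 0) (s.r 6) p q r := by
  refine Wp.seq (T := 15) (U := 25) (Q := fun s' => HitFrame s s' ∧
    firstHit (s.r 0) (s.r 6) p q r = firstRoot (s'.r 6) (s'.r 14) (s'.r 15) (s'.r 16))
    (Wp.block (by decide) ?_) ?_
  · simp only [coeffCode, BlockPost]
    refine ⟨⟨by simp only [Store.setR_n], by simp only [Store.setR_nm],
      by simp only [Store.setR_rm], fun k hk => ?_⟩, ?_⟩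
    · have : k ≠ 7 ∧ k ≠ 8 ∧ k ≠ 11 ∧ k ≠ 12 ∧ k ≠ 14 ∧ k ≠ 15 ∧ k ≠ 16 ∧ k ≠ 17 := by omega
      simp [this]
    · simp [firstHit, hp, hp', hq, hq', hr, hr']
  · rintro s₁ ⟨f, e⟩
    refine (rootCmd_spec S s₁ (by rw [f.r 1 (by decide), h1]) (by rw [f.r 2 (by decide), h2])
      (by rw [f.r 3 (by decide), h3])).mono le_rfl ?_
    rintro s₂ ⟨f', e'⟩
    exact ⟨⟨f'.n.trans f.n, f'.nm.trans f.nm, f'.rm.trans f.rm,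
      fun k hk => (f'.r k hk).trans (f.r k hk)⟩, by rw [e, e']⟩

theorem adr_le_adr {n a i j a' i' j' : ℕ} (ha : a ≤ a') (hi : i ≤ i') (hj : j ≤ j') :
    adr n a i j ≤ adr n a' i' j' := by
  unfold adr
  gcongr

theorem mul_add_inj {n x y j k : ℕ} (hj : j < n) (hk : k < n) (h : x * n + j = y * n + k) :
    x = y ∧ j = k := by
  have hn : 0 < n := by omega
  have h1 := congrArg (· / n) h
  have h2 := congrArg (· % n) h
  simp only [Nat.mul_comm _ n, Nat.mul_add_div hn, Nat.div_eq_of_lt hj, Nat.div_eq_of_lt hk,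
    Nat.mul_add_mod, Nat.mod_eq_of_lt hj, Nat.mod_eq_of_lt hk] at h1 h2
  exact ⟨by omega, h2⟩

theorem adr_inj {n a i j a' i' j' : ℕ} (hi : i < n) (hi' : i' < n) (hj : j < n) (hj' : j' < n)
    (h : adr n a i j = adr n a' i' j') : a = a' ∧ i = i' ∧ j = j' := by
  unfold adr at h
  obtain ⟨h1, h2⟩ := mul_add_inj hj hj' (x := a * n + i) (y := a' * n + i') (by omega)
  obtain ⟨h3, h4⟩ := mul_add_inj hi hi' h1
  exact ⟨h3, h4, h2⟩

theorem two_mul_le_adr (n a i j : ℕ) : 2 * n ≤ adr n a i j := by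
  unfold adr
  omega

theorem le_adr {n : ℕ} (hn : 0 < n) (a i j : ℕ) : a ≤ adr n a i j := by
  unfold adr
  have h1 := Nat.le_mul_of_pos_right a hn
  have h2 := Nat.le_mul_of_pos_right (a * n + i) hn
  omega

/-- The registers that hold constants, and the coordinates of the vertices `p 0, …, p m` in the real
memory. -/
structure Ctx (m : ℕ) (ε : ℝ) (p : ℕ → Plane) (s : Store) : Prop where
  n0 : s.n 0 = m + 1
  n1 : s.n 1 = m
  n2 : s.n 2 = 1
  n13 : s.n 13 = (m + 1) * (m + 1)
  n15 : s.n 15 = 0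
  n16 : s.n 16 = m - 1
  r0 : s.r 0 = ε
  r1 : s.r 1 = 1
  r2 : s.r 2 = 0
  r3 : s.r 3 = 2
  vertex : ∀ k ≤ m, s.rm (2 * k) = p k 0 ∧ s.rm (2 * k + 1) = p k 1

/-- The entry of the table with address `A` is `v`. The predecessor matters only for finite
entries. -/
def Cell (s : Store) (A : ℕ) (v : ℝ × ℕ × ℕ) : Prop :=
  s.rm A = v.1 ∧ (v.1 ≤ 1 → s.nm (2 * A) = v.2.1 ∧ s.nm (2 * A + 1) = v.2.2)

/-- Outside of the entry of the table with address `A`, the memories agree. -/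
def AgreeOff (s s' : Store) (A : ℕ) : Prop :=
  ∀ B ≠ A, s'.rm B = s.rm B ∧ s'.nm (2 * B) = s.nm (2 * B) ∧ s'.nm (2 * B + 1) = s.nm (2 * B + 1)

theorem Cell.of_agreeOff {s s' : Store} {A B : ℕ} {v : ℝ × ℕ × ℕ} (h : Cell s B v)
    (hs : AgreeOff s s' A) (hB : B ≠ A) : Cell s' B v := by
  obtain ⟨h1, h2, h3⟩ := hs B hB
  unfold Cell
  rw [h1, h2, h3]
  exact h

theorem Ctx.of_agree {m : ℕ} {ε : ℝ} {p : ℕ → Plane} {s s' : Store} (h : Ctx m ε p s)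
    (hn : ∀ k, k ≤ 2 ∨ k = 13 ∨ k = 15 ∨ k = 16 → s'.n k = s.n k)
    (hr : ∀ k ≤ 3, s'.r k = s.r k) (hrm : ∀ A < 2 * (m + 1), s'.rm A = s.rm A) :
    Ctx m ε p s' where
  n0 := (hn 0 (by omega)).trans h.n0
  n1 := (hn 1 (by omega)).trans h.n1
  n2 := (hn 2 (by omega)).trans h.n2
  n13 := (hn 13 (by omega)).trans h.n13
  n15 := (hn 15 (by omega)).trans h.n15
  n16 := (hn 16 (by omega)).trans h.n16
  r0 := (hr 0 (by omega)).trans h.r0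
  r1 := (hr 1 (by omega)).trans h.r1
  r2 := (hr 2 (by omega)).trans h.r2
  r3 := (hr 3 (by omega)).trans h.r3
  vertex k hk := by
    rw [hrm _ (by omega), hrm _ (by omega)]
    exact h.vertex k hk

section Verification

variable {S m : ℕ} {ε : ℝ} {p : ℕ → Plane}

theorem vertexHitCmd_spec {s : Store} (hc : Ctx m ε p s) {ra rb rc i j k : ℕ}
    (hb : rb ≠ 8) (hc' : rc ≠ 8) (hi : s.n ra = i) (hj : s.n rb = j) (hk : s.n rc = k)
    (him : i ≤ m) (hjm : j ≤ m) (hkm : k ≤ m) (hS : 2 * (m + 1) < S) :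
    Wp S (vertexHitCmd ra rb rc) 52 s fun s' => (∀ x ≠ 8, s'.n x = s.n x) ∧ s'.nm = s.nm ∧
      s'.rm = s.rm ∧ (∀ x < 7, s'.r x = s.r x) ∧
      s'.r 13 = firstHit ε (s.r 6) (p i) (p j) (p k) := by
  refine Wp.seq (T := 12) (U := 40) (Q := fun s' => (∀ x ≠ 8, s'.n x = s.n x) ∧ s'.nm = s.nm ∧
      s'.rm = s.rm ∧ (∀ x < 7, s'.r x = s.r x) ∧ s'.r 7 = p i 0 ∧ s'.r 8 = p i 1 ∧
      s'.r 9 = p j 0 ∧ s'.r 10 = p j 1 ∧ s'.r 11 = p k 0 ∧ s'.r 12 = p k 1)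
    (Wp.block (by simp [vertexCode]) ?_) ?_
  · have h2 := hc.n2
    refine blockPost_vertexCode hi h2 (by omega) ?_
    refine blockPost_vertexCode (k := j) (by simp [hb, hj]) (by simpa using h2) (by omega) ?_
    refine blockPost_vertexCode (k := k) (by simp [hc', hk]) (by simpa using h2) (by omega) ?_
    obtain ⟨i1, i2⟩ := hc.vertex i him
    obtain ⟨j1, j2⟩ := hc.vertex j hjm
    obtain ⟨k1, k2⟩ := hc.vertex k hkm
    simp only [BlockPost]
    refine ⟨fun x hx => by simp [hx], rfl, rfl, fun x hx => ?_, ?_⟩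
    · have : x ≠ 7 ∧ x ≠ 8 ∧ x ≠ 9 ∧ x ≠ 10 ∧ x ≠ 11 ∧ x ≠ 12 := by omega
      simp [this]
    · simp [i1, i2, j1, j2, k1, k2]
  · rintro s₁ ⟨n₁, nm₁, rm₁, r₁, h7, h8, h9, h10, h11, h12⟩
    refine (hitCmd_spec S s₁ (p i) (p j) (p k) (by rw [r₁ 1 (by omega), hc.r1])
      (by rw [r₁ 2 (by omega), hc.r2]) (by rw [r₁ 3 (by omega), hc.r3]) h7 h8 h9 h10 h11 h12).mono
      le_rfl ?_
    rintro s₂ ⟨f, e⟩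
    refine ⟨fun x hx => ?_, f.nm.trans nm₁, f.rm.trans rm₁, fun x hx => (f.r x hx).trans (r₁ x hx),
      ?_⟩
    · rw [f.n, n₁ x hx]
    · rw [e, r₁ 0 (by omega), r₁ 6 (by omega), hc.r0]

/-- One round of the sweep advances the state of the sweep by one edge, and improves the entry for
vertex `i` and edge `j` of the current level by the link from vertex `c`. -/
theorem sweepCmd_spec {s : Store} (hctx : Ctx m ε p s) {B : ℕ → ℕ → ℝ} {a i c j : ℕ}
    (h3 : s.n 3 = a) (h12 : s.n 12 = a + 1) (h4 : s.n 4 = i) (h5 : s.n 5 = c) (h6 : s.n 6 = j)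
    (h7 : s.n 7 = (sweep ε p (B c) c i j).2) (hr4 : s.r 4 = (sweep ε p (B c) c i j).1)
    (hi : i ≤ m) (hci : c < i) (hj : j < m) (hB : s.rm (adr (m + 1) a c j) = B c j)
    (hcell : Cell s (adr (m + 1) (a + 1) i j) (bestLink ε p B i j c))
    (hS : 2 * adr (m + 1) (a + 1) m m + 1 < S) :
    Wp S sweepCmd 160 s fun s' => Ctx m ε p s' ∧
      (s'.n 3 = a ∧ s'.n 12 = a + 1 ∧ s'.n 4 = i ∧ s'.n 5 = c ∧ s'.n 6 = j + 1) ∧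
      s'.n 7 = (sweep ε p (B c) c i (j + 1)).2 ∧ s'.r 4 = (sweep ε p (B c) c i (j + 1)).1 ∧
      Cell s' (adr (m + 1) (a + 1) i j) (bestLink ε p B i j (c + 1)) ∧
      AgreeOff s s' (adr (m + 1) (a + 1) i j) := by
  have hA1 : adr (m + 1) a c j ≤ adr (m + 1) (a + 1) m m :=
    adr_le_adr (by omega) (by omega) (by omega)
  have hA2 : adr (m + 1) (a + 1) i j ≤ adr (m + 1) (a + 1) m m :=
    adr_le_adr le_rfl hi (by omega)
  have hA3 := two_mul_le_adr (m + 1) (a + 1) i j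
  have h0 := hctx.n0
  have h2 := hctx.n2
  set A := adr (m + 1) (a + 1) i j with hA
  set M := adr (m + 1) (a + 1) m m
  have hload : Wp S (.block (adrCode 3 5 6 ++ [.rLoad 5 8, .nAdd 14 6 2])) 8 s fun s' =>
      s' = ((s.setN 8 (adr (m + 1) a c j)).setR 5 (B c j)).setN 14 (j + 1) := by
    refine Wp.block (by decide) (blockPost_adrCode (by decide) (by decide) (by omega) ?_ ?_) <;>
      rw [h0, h3, h5, h6]
    · omega
    · simp [BlockPost, hB, h6, h2]
      omega
  -- Load `B c j`, then choose the lower bound and the entering edge for `exitParam`.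
  refine Wp.seq (T := 8) (U := 152) hload ?_
  rintro _ rfl
  set s₁ := ((s.setN 8 (adr (m + 1) a c j)).setR 5 (B c j)).setN 14 (j + 1) with hs₁
  refine Wp.seq (T := 4) (U := 148) (Q := fun s' => s' =
    (s₁.setR 6 (if 1 < (sweep ε p (B c) c i j).1 then B c j else 0)).setN 11
      (exitSource ε p (B c) c i j)) (Wp.cond (T := 2) (fun h => Wp.block (by decide) ?_)
      (fun h => Wp.block (by decide) ?_)) ?_
  · simp [Cond.Holds, hs₁, hctx.r1, hr4] at h
    simp [BlockPost, hs₁, h6, exitSource, h]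
    omega
  · simp [Cond.Holds, hs₁, hctx.r1, hr4] at h
    have := sweep_snd_le (ε := ε) (p := p) (B := B c) (c := c) (i := i) j
    simp [BlockPost, hs₁, h7, hctx.r2, exitSource, not_lt.2 h]
    omega
  rintro _ rfl
  set s₂ := (s₁.setR 6 (if 1 < (sweep ε p (B c) c i j).1 then B c j else 0)).setN 11
      (exitSource ε p (B c) c i j) with hs₂
  have hctx₂ : Ctx m ε p s₂ := hctx.of_agree
    (fun k hk => by
      have : k ≠ 8 ∧ k ≠ 14 ∧ k ≠ 11 := by omega
      simp [hs₂, hs₁, this])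
    (fun k hk => by
      have : k ≠ 5 ∧ k ≠ 6 := by omega
      simp [hs₂, hs₁, this])
    (fun k hk => rfl)
  refine Wp.seq (T := 52) (U := 96) (vertexHitCmd_spec hctx₂ (i := i) (j := j) (k := j + 1)
    (by decide) (by decide) (by simp [hs₂, hs₁, h4]) (by simp [hs₂, hs₁, h6])
    (by simp [hs₂, hs₁]) hi (by omega) (by omega) (by omega)) ?_
  rintro s₃ ⟨n₃, nm₃, rm₃, r₃, e₃⟩
  replace e₃ : s₃.r 13 = exitParam ε p (B c) c i j := by
    rw [e₃]; simp [hs₂, exitParam]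
  have hn₃ : ∀ x, x ≠ 8 → x ≠ 11 → x ≠ 14 → s₃.n x = s.n x := fun x a b d => by
    rw [n₃ x a]; simp [hs₂, hs₁, a, b, d]
  have e11 : s₃.n 11 = exitSource ε p (B c) c i j := by rw [n₃ 11 (by decide)]; simp [hs₂]
  have e14 : s₃.n 14 = j + 1 := by rw [n₃ 14 (by decide)]; simp [hs₂, hs₁]
  have hr₃ : ∀ x < 7, x ≠ 5 → x ≠ 6 → s₃.r x = s.r x := fun x a b d => by
    rw [r₃ x a]; simp [hs₂, hs₁, b, d]
  have e5 : s₃.r 5 = B c j := by rw [r₃ 5 (by decide)]; simp [hs₂, hs₁]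
  replace nm₃ : s₃.nm = s.nm := nm₃
  replace rm₃ : s₃.rm = s.rm := rm₃
  -- Compare `exitParam` with the entry, and replace the entry together with its predecessor.
  have hold : Wp S (.block (adrCode 12 4 6 ++ [.rLoad 14 8])) 7 s₃ fun s' =>
      s' = (s₃.setN 8 A).setR 14 (bestLink ε p B i j c).1 := by
    refine Wp.block (by decide) (blockPost_adrCode (by decide) (by decide) ?_ ?_ ?_) <;>
      rw [hn₃ 0 (by decide) (by decide) (by decide), h0]
    · omega
    all_goals rw [hn₃ 12 (by decide) (by decide) (by decide),
      hn₃ 4 (by decide) (by decide) (by decide), hn₃ 6 (by decide) (by decide) (by decide),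
      h12, h4, h6, ← hA]
    · omega
    · simp [BlockPost, rm₃, hcell.1]
      omega
  refine Wp.seq (T := 7) (U := 89) hold ?_
  rintro _ rfl
  refine Wp.seq (T := 7) (U := 82) (Q := fun s' => (∀ x, x ≠ 8 → x ≠ 9 → s'.n x = s₃.n x) ∧
    (∀ x < 7, s'.r x = s₃.r x) ∧ Cell s' A (bestLink ε p B i j (c + 1)) ∧ AgreeOff s s' A)
    (Wp.cond (T := 5) (fun h => Wp.block (by decide) ?_) (fun h => Wp.block (by decide) ?_)) ?_
  · simp [Cond.Holds, e₃] at h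
    simp only [BlockPost]
    simp [hn₃, e11, e₃, h2, h5]
    have hb : bestLink ε p B i j (c + 1) =
        (exitParam ε p (B c) c i j, c, exitSource ε p (B c) c i j) := by simp [bestLink, h]
    rw [hb]
    refine ⟨by omega, by omega, by omega, fun x h8 h9 => by simp [h8, h9],
      fun x hx => ?_, ?_, ?_⟩
    · have : x ≠ 14 := by omega
      simp [this]
    · simp [Cell, ← two_mul]
    · intro D hD
      have : D + D ≠ A + A ∧ D + D ≠ A + A + 1 ∧ D + D + 1 ≠ A + A := by omega
      simp [hD, two_mul, this, nm₃, rm₃]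
  · simp [Cond.Holds, e₃] at h
    have hb : bestLink ε p B i j (c + 1) = bestLink ε p B i j c := by simp [bestLink, not_lt.2 h]
    rw [hb]
    refine ⟨fun x h8 h9 => by simp [h8], fun x hx => ?_, ?_, ?_⟩
    · have : x ≠ 14 := by omega
      simp [this]
    · simpa [Cell, rm₃, nm₃] using hcell
    · intro D hD
      simp [rm₃, nm₃]
  rintro s₅ ⟨n₅, r₅, hcell₅, agree₅⟩
  -- Advance the state of the sweep to the next vertex.
  refine Wp.seq (T := 4) (U := 78) (Q := fun s' => (∀ x ≠ 7, s'.n x = s₅.n x) ∧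
    s'.n 7 = (sweep ε p (B c) c i (j + 1)).2 ∧ (∀ x ≠ 6, s'.r x = s₅.r x) ∧
    s'.r 6 = (if 1 < B c j then (sweep ε p (B c) c i j).1 else 0) ∧ s'.nm = s₅.nm ∧ s'.rm = s₅.rm)
    (Wp.cond (T := 2) (fun h => Wp.block (by decide) ?_) (fun h => Wp.block (by decide) ?_)) ?_
  · simp [Cond.Holds, r₅, e5, hr₃, hctx.r1] at h
    simp only [BlockPost]
    refine ⟨fun x hx => rfl, ?_, fun x hx => by simp [hx], ?_, rfl, rfl⟩
    · simp [n₅, hn₃, h7, sweep, h]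
    · simp [r₅, hr₃, hr4, h]
  · simp [Cond.Holds, r₅, e5, hr₃, hctx.r1] at h
    simp only [BlockPost]
    refine ⟨by simp [n₅, hn₃, h6]; omega, fun x hx => by simp [hx], ?_, fun x hx => by simp [hx],
      ?_, rfl, rfl⟩
    · simp [n₅, hn₃, h6, sweep, not_lt.2 h]
    · simp [r₅, hr₃, hctx.r2, not_lt.2 h]
  rintro s₆ ⟨n₆, e7, r₆, e6, nm₆, rm₆⟩
  have hn₆ : ∀ x, x ≠ 8 → x ≠ 9 → x ≠ 11 → x ≠ 14 → x ≠ 7 → s₆.n x = s.n x := by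
    intro x a b d e f
    rw [n₆ x f, n₅ x a b, hn₃ x a d e]
  have e14' : s₆.n 14 = j + 1 := by simp [n₆, n₅, e14]
  have hctx₆ : Ctx m ε p s₆ := hctx.of_agree
    (fun k hk => hn₆ k (by omega) (by omega) (by omega) (by omega) (by omega))
    (fun k hk => by
      rw [r₆ k (by omega), r₅ k (by omega), hr₃ k (by omega) (by omega) (by omega)])
    (fun k hk => by rw [rm₆]; exact (agree₅ k (by omega)).1)
  refine Wp.seq (T := 52) (U := 26) (vertexHitCmd_spec hctx₆ (i := j + 1) (j := c) (k := i)
    (by decide) (by decide) e14' (by simp [hn₆, h5])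
    (by simp [hn₆, h4]) (by omega) (by omega) (by omega) (by omega)) ?_
  rintro s₇ ⟨n₇, nm₇, rm₇, r₇, e₇⟩
  refine Wp.block (by simp) ?_
  simp only [BlockPost]
  have e14'' : s₇.n 14 = j + 1 := by rw [n₇ 14 (by decide), e14']
  have hn₇ : ∀ x, x ≠ 8 → x ≠ 9 → x ≠ 11 → x ≠ 14 → x ≠ 7 → s₇.n x = s.n x := by
    intro x a b d e f
    rw [n₇ x a, hn₆ x a b d e f]
  refine ⟨by simp [e14'']; omega, hctx₆.of_agree ?_ ?_ ?_, ?_, ?_, ?_, ?_, ?_⟩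
  · intro k hk
    have : k ≠ 6 ∧ k ≠ 8 := by omega
    simp [this, n₇]
  · intro k hk
    have : k ≠ 4 ∧ k < 7 := by omega
    simp [this, r₇]
  · intro k hk
    simp [rm₇]
  · simp [hn₇, e14'', h3, h12, h4, h5]
  · simp [n₇, e7]
  · simp [e₇, e6, sweep]
  · simpa [Cell, rm₇, nm₇, nm₆, rm₆] using hcell₅
  · intro D hD
    simpa [rm₇, nm₇, nm₆, rm₆] using agree₅ D hD

end Verification
theorem adr_eq_add (n a i j : ℕ) : adr n a i j = adr n a 0 0 + (i * n + j) := by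
  unfold adr
  ring

theorem mul_add_lt {m i j : ℕ} (hi : i ≤ m) (hj : j ≤ m) :
    i * (m + 1) + j < (m + 1) * (m + 1) := by
  have := Nat.mul_le_mul_right (m + 1) hi
  rw [Nat.succ_mul m]
  omega

theorem adr_lt_adr_succ {m a a' i j : ℕ} (ha : a < a') (hi : i ≤ m) (hj : j ≤ m) :
    adr (m + 1) a i j < adr (m + 1) a' 0 0 := by
  refine lt_of_lt_of_le ?_ (adr_le_adr (Nat.succ_le_of_lt ha) le_rfl le_rfl)
  have := mul_add_lt hi hj
  have e : adr (m + 1) (a + 1) 0 0 = adr (m + 1) a 0 0 + (m + 1) * (m + 1) := by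
    unfold adr
    ring
  rw [adr_eq_add, e]
  omega

/-- The levels up to `a` of the table are complete. -/
def Levels (m : ℕ) (ε : ℝ) (p : ℕ → Plane) (a : ℕ) (s : Store) : Prop :=
  ∀ a' ≤ a, ∀ i ≤ m, ∀ j < m, Cell s (adr (m + 1) a' i j) (table ε p a' i j)

/-- Level `a + 1` of the table under construction: for vertex `i` and edge `j`, the links from the
first `F i j` vertices have been taken into account. -/
def Partial (m : ℕ) (ε : ℝ) (p : ℕ → Plane) (a : ℕ) (F : ℕ → ℕ → ℕ) (s : Store) : Prop :=
  ∀ i ≤ m, ∀ j < m, Cell s (adr (m + 1) (a + 1) i j)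
    (bestLink ε p (fun c j' => (table ε p a c j').1) i j (F i j))

/-- The progress of the computation of a level: the vertices before `i` are finished, and for vertex
`i` the links from the first `c` vertices, and before edge `k` also the next link. -/
def progress (i c k i' j' : ℕ) : ℕ :=
  if i' < i then i' else if i' = i then (if j' < k then c + 1 else c) else 0

section Verification

variable {S m : ℕ} {ε : ℝ} {p : ℕ → Plane}

theorem Levels.of_agreeOff {s s' : Store} {a i j : ℕ} (h : Levels m ε p a s) (hi : i ≤ m)
    (hj : j < m) (hs : AgreeOff s s' (adr (m + 1) (a + 1) i j)) : Levels m ε p a s' :=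
  fun a' ha' i' hi' j' hj' => (h a' ha' i' hi' j' hj').of_agreeOff hs fun e => by
    have := (adr_inj (by omega) (by omega) (by omega) (by omega) e).1
    omega

theorem Partial.update {s s' : Store} {a i j : ℕ} {F F' : ℕ → ℕ → ℕ} (h : Partial m ε p a F s)
    (hi : i ≤ m) (hj : j < m) (hs : AgreeOff s s' (adr (m + 1) (a + 1) i j))
    (hc : Cell s' (adr (m + 1) (a + 1) i j)
      (bestLink ε p (fun c j' => (table ε p a c j').1) i j (F' i j)))
    (hF : ∀ i' j', ¬ (i' = i ∧ j' = j) → F' i' j' = F i' j') : Partial m ε p a F' s' := by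
  intro i' hi' j' hj'
  by_cases e : i' = i ∧ j' = j
  · obtain ⟨rfl, rfl⟩ := e
    exact hc
  · rw [hF i' j' e]
    exact (h i' hi' j' hj').of_agreeOff hs fun e' =>
      e (adr_inj (by omega) (by omega) (by omega) (by omega) e').2

theorem Partial.congr {s : Store} {a : ℕ} {F F' : ℕ → ℕ → ℕ} (h : Partial m ε p a F s)
    (hF : ∀ i' ≤ m, ∀ j' < m, F' i' j' = F i' j') : Partial m ε p a F' s := by
  intro i hi j hj
  rw [hF i hi j hj]
  exact h i hi j hj

theorem Levels.of_eq {s s' : Store} {a : ℕ} (h : Levels m ε p a s) (hrm : s'.rm = s.rm)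
    (hnm : s'.nm = s.nm) : Levels m ε p a s' := by
  intro a' ha' i hi j hj
  unfold Cell
  rw [hrm, hnm]
  exact h a' ha' i hi j hj

theorem Partial.of_eq {s s' : Store} {a : ℕ} {F : ℕ → ℕ → ℕ} (h : Partial m ε p a F s)
    (hrm : s'.rm = s.rm) (hnm : s'.nm = s.nm) : Partial m ε p a F s' := by
  intro i hi j hj
  unfold Cell
  rw [hrm, hnm]
  exact h i hi j hj

/-- Clearing a level leaves the integer memory alone: the predecessor of an entry `2` does not
matter. -/
theorem clearCmd_spec {s : Store} (hctx : Ctx m ε p s) {a : ℕ} (h12 : s.n 12 = a)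
    (hS : 2 * adr (m + 1) a m m + 1 < S) :
    Wp S clearCmd ((m + 1) * (m + 1) * 9 + 3) s fun s' => Ctx m ε p s' ∧
      (∀ x, x ≠ 8 → x ≠ 10 → s'.n x = s.n x) ∧ s'.r = s.r ∧ s'.nm = s.nm ∧
      (∀ A < adr (m + 1) a 0 0, s'.rm A = s.rm A) ∧
      ∀ i ≤ m, ∀ j ≤ m, s'.rm (adr (m + 1) a i j) = 2 := by
  have hbase := two_mul_le_adr (m + 1) a 0 0
  have hmm := adr_eq_add (m + 1) a m m
  have hmm' : m * (m + 1) + m + 1 = (m + 1) * (m + 1) := by ring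
  let I : ℕ → Store → Prop := fun k s' =>
      (∀ x, x ≠ 8 → x ≠ 10 → s'.n x = s.n x) ∧ s'.n 10 = k ∧ s'.r = s.r ∧ s'.nm = s.nm ∧
      (∀ A < adr (m + 1) a 0 0, s'.rm A = s.rm A) ∧
      ∀ k' < k, s'.rm (adr (m + 1) a 0 0 + k') = 2
  have h0 := hctx.n0
  have h2 := hctx.n2
  have h13 := hctx.n13
  have h15 := hctx.n15
  have hr3 := hctx.r3
  rw [show (m + 1) * (m + 1) * 9 + 3 = 1 + ((m + 1) * (m + 1) * (8 + 1) + 2) by ring]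
  refine Wp.seq (Q := I 0) (Wp.block (by decide) ?_) fun s₁ h₁ =>
    (Wp.loop I h₁ ?_ ?_).mono le_rfl ?_
  · simp only [BlockPost]
    exact ⟨by omega, fun x _ h => by simp [h], by simp, rfl, rfl, fun A _ => rfl,
      fun k' hk' => by omega⟩
  · rintro k hk s' ⟨hn, h10, hr, hnm, hlow, htwo⟩
    have n0 := (hn 0 (by decide) (by decide)).trans h0
    have n2 := (hn 2 (by decide) (by decide)).trans h2
    have n12 := (hn 12 (by decide) (by decide)).trans h12
    have n13 := (hn 13 (by decide) (by decide)).trans h13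
    have n15 := (hn 15 (by decide) (by decide)).trans h15
    have e : adr (m + 1) a 0 k = adr (m + 1) a 0 0 + k := by simpa using adr_eq_add (m + 1) a 0 k
    refine ⟨by simp only [Cond.Holds]; omega, Wp.block (by decide)
      (blockPost_adrCode (by decide) (by decide) (by omega) ?_ ?_)⟩ <;>
      rw [n0, n12, n15, h10, e]
    · omega
    · simp only [BlockPost]
      refine ⟨by simp; omega, by simp [h10, n2]; omega, fun x h8 h10' => ?_, ?_, ?_, ?_,
        fun A hA => ?_, fun k' hk' => ?_⟩
      · simp [h8, h10', hn]
      · simp [h10, n2]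
      · simp [hr]
      · simp [hnm]
      · have : A ≠ adr (m + 1) a 0 0 + k := by omega
        simp [this, hlow A hA]
      · rcases Nat.lt_succ_iff_lt_or_eq.1 hk' with hlt | rfl
        · have : k' ≠ k := by omega
          simp [this, htwo k' hlt]
        · simp [hr, hr3]
  · rintro s' ⟨hn, h10, -⟩
    have n13 := (hn 13 (by decide) (by decide)).trans h13
    simp only [Cond.Holds]
    omega
  · rintro s' ⟨hn, h10, hr, hnm, hlow, htwo⟩
    refine ⟨hctx.of_agree (fun k hk => hn k (by omega) (by omega)) (fun k _ => by rw [hr])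
      (fun A hA => hlow A (by omega)), hn, hr, hnm, hlow, fun i hi j hj => ?_⟩
    rw [adr_eq_add]
    exact htwo _ (mul_add_lt hi hj)

/-- The state of the registers while the links to vertex `i` are processed. -/
def LinkRegs (a i c : ℕ) (s : Store) : Prop :=
  s.n 3 = a ∧ s.n 12 = a + 1 ∧ s.n 4 = i ∧ s.n 5 = c

theorem columnCmd_spec {s : Store} (hctx : Ctx m ε p s) {a i c : ℕ} (hreg : LinkRegs a i c s)
    (hi : i ≤ m) (hci : c < i) (hlev : Levels m ε p a s)
    (hpart : Partial m ε p a (progress i c 0) s) (hS : 2 * adr (m + 1) (a + 1) m m + 1 < S) :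
    Wp S columnCmd (m * 161 + 6) s fun s' => Ctx m ε p s' ∧ LinkRegs a i (c + 1) s' ∧
      Levels m ε p a s' ∧ Partial m ε p a (progress i (c + 1) 0) s' := by
  have hbig := two_mul_le_adr (m + 1) (a + 1) m m
  let B : ℕ → ℕ → ℝ := fun c j' => (table ε p a c j').1
  let I : ℕ → Store → Prop := fun k s' => Ctx m ε p s' ∧ (LinkRegs a i c s' ∧ s'.n 6 = k) ∧
    s'.n 7 = (sweep ε p (B c) c i k).2 ∧ s'.r 4 = (sweep ε p (B c) c i k).1 ∧
    Levels m ε p a s' ∧ Partial m ε p a (progress i c k) s'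
  rw [show m * 161 + 6 = 3 + ((m * (160 + 1) + 2) + 1) by ring]
  refine Wp.seq (Q := I 0) (Wp.block (by decide) ?_) fun s₁ h₁ =>
    Wp.seq (Wp.loop (N := m) I h₁ ?_ ?_) ?_
  · simp only [BlockPost]
    obtain ⟨h3, h12, h4, h5⟩ := hreg
    refine ⟨by omega, by omega, hctx.of_agree (fun k hk => ?_) (fun k hk => ?_) (fun _ _ => rfl),
      ⟨⟨by simpa using h3, by simpa using h12, by simpa using h4, by simpa using h5⟩, by simp⟩,
      by simp [sweep], by simp [sweep, hctx.r3], hlev.of_eq rfl rfl, hpart.of_eq rfl rfl⟩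
    · have : k ≠ 6 ∧ k ≠ 7 := by omega
      simp [this]
    · have : k ≠ 4 := by omega
      simp [this]
  · rintro k hk s' ⟨hctx', ⟨⟨h3, h12, h4, h5⟩, h6⟩, h7, hr4, hlev', hpart'⟩
    refine ⟨by simp only [Cond.Holds]; rw [h6, hctx'.n1]; exact hk, ?_⟩
    have hcell := hpart' i hi k hk
    rw [show progress i c k i k = c by simp [progress]] at hcell
    refine (sweepCmd_spec (B := B) hctx' h3 h12 h4 h5 h6 h7 hr4 hi hci hk
      (hlev' a le_rfl c (by omega) k hk).1 hcell hS).mono le_rfl ?_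
    rintro s₂ ⟨c₂, ⟨g3, g12, g4, g5, g6⟩, g7, gr4, gcell, gagree⟩
    refine ⟨c₂, ⟨⟨g3, g12, g4, g5⟩, g6⟩, g7, gr4, hlev'.of_agreeOff hi hk gagree,
      hpart'.update hi hk gagree ?_ ?_⟩
    · rw [show progress i c (k + 1) i k = c + 1 by simp [progress]]
      exact gcell
    · intro i' j' hne
      unfold progress
      split_ifs <;> omega
  · rintro s' ⟨hctx', ⟨-, h6⟩, -⟩
    simp only [Cond.Holds]
    rw [h6, hctx'.n1]
    exact lt_irrefl m
  · rintro s' ⟨hctx', ⟨⟨h3, h12, h4, h5⟩, h6⟩, h7, hr4, hlev', hpart'⟩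
    refine Wp.block (by decide) ?_
    have h2 := hctx'.n2
    simp only [BlockPost]
    refine ⟨by omega, hctx'.of_agree (fun k hk => ?_) (fun _ _ => rfl) (fun _ _ => rfl),
      ⟨by simpa using h3, by simpa using h12, by simpa using h4, by simp [h5, h2]⟩,
      hlev'.of_eq rfl rfl, (hpart'.congr fun i' _ j' hj' => ?_).of_eq rfl rfl⟩
    · have : k ≠ 5 := by omega
      simp [this]
    · unfold progress
      split_ifs <;> omega

theorem vertexCmd_spec {s : Store} (hctx : Ctx m ε p s) {a i : ℕ}
    (h3 : s.n 3 = a) (h12 : s.n 12 = a + 1) (h4 : s.n 4 = i)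
    (hi : i ≤ m) (hlev : Levels m ε p a s)
    (hpart : Partial m ε p a (progress i 0 0) s) (hS : 2 * adr (m + 1) (a + 1) m m + 1 < S) :
    Wp S vertexCmd (m * (m * 161 + 7) + 4) s fun s' => Ctx m ε p s' ∧
      (s'.n 3 = a ∧ s'.n 12 = a + 1 ∧ s'.n 4 = i + 1) ∧
      Levels m ε p a s' ∧ Partial m ε p a (progress (i + 1) 0 0) s' := by
  have hbig := two_mul_le_adr (m + 1) (a + 1) m m
  let I : ℕ → Store → Prop := fun c s' => Ctx m ε p s' ∧ LinkRegs a i c s' ∧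
    Levels m ε p a s' ∧ Partial m ε p a (progress i c 0) s'
  have hT : 1 + ((i * ((m * 161 + 6) + 1) + 2) + 1) ≤ m * (m * 161 + 7) + 4 := by
    have := Nat.mul_le_mul_right (m * 161 + 6 + 1) hi
    change _ ≤ m * (m * 161 + 6 + 1) + 4
    omega
  refine Wp.mono (Wp.seq (Q := I 0) (Wp.block (T := 1) (by decide) ?_) fun s₁ h₁ =>
    Wp.seq (Wp.loop (N := i) I h₁ ?_ ?_) ?_) hT (fun _ h => h)
  · simp only [BlockPost]
    refine ⟨by omega, hctx.of_agree (fun k hk => ?_) (fun _ _ => rfl) (fun _ _ => rfl),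
      ⟨by simpa using h3, by simpa using h12, by simpa using h4, by simp⟩,
      hlev.of_eq rfl rfl, hpart.of_eq rfl rfl⟩
    have : k ≠ 5 := by omega
    simp [this]
  · rintro c hc s' ⟨hctx', hreg, hlev', hpart'⟩
    exact ⟨by simp only [Cond.Holds]; rw [hreg.2.2.1, hreg.2.2.2]; exact hc,
      columnCmd_spec hctx' hreg hi hc hlev' hpart' hS⟩
  · rintro s' ⟨-, ⟨-, -, g4, g5⟩, -⟩
    simp only [Cond.Holds]
    omega
  · rintro s' ⟨hctx', ⟨g3, g12, g4, g5⟩, hlev', hpart'⟩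
    refine Wp.block (T := 1) (by decide) ?_
    have h2 := hctx'.n2
    simp only [BlockPost]
    refine ⟨by omega, hctx'.of_agree (fun k hk => ?_) (fun _ _ => rfl) (fun _ _ => rfl),
      ⟨by simpa using g3, by simpa using g12, by simp [g4, h2]⟩,
      hlev'.of_eq rfl rfl, (hpart'.congr fun i' _ j' hj' => ?_).of_eq rfl rfl⟩
    · have : k ≠ 4 := by omega
      simp [this]
    · unfold progress
      split_ifs <;> omega

theorem testCmd_spec {s : Store} (hctx : Ctx m ε p s) (hm : 0 < m) {a : ℕ} (h12 : s.n 12 = a)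
    (hlev : Levels m ε p a s) (hS : 2 * adr (m + 1) a m m + 1 < S) :
    Wp S testCmd 7 s fun s' => Ctx m ε p s' ∧ s'.n 12 = a ∧ s'.nm = s.nm ∧ Levels m ε p a s' ∧
      s'.r 19 = (table ε p a m (m - 1)).1 := by
  have hle : adr (m + 1) a m (m - 1) ≤ adr (m + 1) a m m := adr_le_adr le_rfl le_rfl (by omega)
  have h0 := hctx.n0
  refine Wp.block (by decide) (blockPost_adrCode (by decide) (by decide) (by omega) ?_ ?_) <;>
    rw [hctx.n0, h12, hctx.n1, hctx.n16]
  · omega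
  · simp only [BlockPost]
    refine ⟨by simp; omega, hctx.of_agree (fun k hk => ?_) (fun k hk => ?_) (fun _ _ => rfl),
      by simpa using h12, rfl, hlev.of_eq rfl rfl, ?_⟩
    · have : k ≠ 8 := by omega
      simp [this]
    · have : k ≠ 19 := by omega
      simp [this]
    · simpa using (hlev a le_rfl m le_rfl (m - 1) (by omega)).1

/-- One round of the main loop completes the next level in `O((m + 1) ^ 3)` steps and loads the
entry that decides whether the loop goes on. -/
theorem levelCmd_spec {s : Store} (hctx : Ctx m ε p s) (hm : 0 < m) {a : ℕ} (h12 : s.n 12 = a)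
    (hlev : Levels m ε p a s) (hS : 2 * adr (m + 1) (a + 1) m m + 1 < S) :
    Wp S levelCmd (200 * (m + 1) ^ 3) s fun s' => Ctx m ε p s' ∧ s'.n 12 = a + 1 ∧
      Levels m ε p (a + 1) s' ∧ s'.r 19 = (table ε p (a + 1) m (m - 1)).1 := by
  have hbig := two_mul_le_adr (m + 1) (a + 1) m m
  have hlt : ∀ a' ≤ a, ∀ i ≤ m, ∀ j < m, adr (m + 1) a' i j < adr (m + 1) (a + 1) 0 0 :=
    fun a' ha' i hi j hj => adr_lt_adr_succ (by omega) hi hj.le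
  have hT : 3 + (((m + 1) * (m + 1) * 9 + 3) +
      (((m + 1) * ((m * (m * 161 + 7) + 4) + 1) + 2) + 7)) ≤ 200 * (m + 1) ^ 3 := by
    ring_nf
    nlinarith [Nat.zero_le (m ^ 2), Nat.zero_le (m ^ 3)]
  let I : ℕ → Store → Prop := fun i s' => Ctx m ε p s' ∧
      (s'.n 3 = a ∧ s'.n 12 = a + 1 ∧ s'.n 4 = i) ∧
      Levels m ε p a s' ∧ Partial m ε p a (progress i 0 0) s'
  have h2 := hctx.n2
  refine Wp.mono (Wp.seq (T := 3) (Q := fun s' => Ctx m ε p s' ∧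
    (s'.n 3 = a ∧ s'.n 12 = a + 1 ∧ s'.n 4 = 0) ∧ Levels m ε p a s')
    (Wp.block (by decide) ?_) ?_) hT (fun _ h => h)
  · have hle := le_adr (n := m + 1) m.succ_pos (a + 1) m m
    simp only [BlockPost]
    refine ⟨by omega, by simp [h12, h2]; omega, by omega,
      hctx.of_agree (fun k hk => ?_) (fun _ _ => rfl) (fun _ _ => rfl),
      ⟨by simp [h12], by simp [h12, h2], by simp⟩, hlev.of_eq rfl rfl⟩
    have : k ≠ 3 ∧ k ≠ 12 ∧ k ≠ 4 := by omega
    simp [this]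
  rintro s₁ ⟨c₁, ⟨g3, g12, g4⟩, l₁⟩
  refine Wp.seq (Q := I 0) ((clearCmd_spec c₁ g12 hS).mono le_rfl ?_) fun s₂ h₂ =>
    Wp.seq (Wp.loop (N := m + 1) I h₂ ?_ ?_) ?_
  · rintro s₂ ⟨c₂, n₂, r₂, nm₂, low₂, two₂⟩
    refine ⟨c₂, ⟨by simp [n₂, g3], by simp [n₂, g12], by simp [n₂, g4]⟩, ?_, ?_⟩
    · intro a' ha' i hi j hj
      unfold Cell
      rw [nm₂, low₂ _ (hlt a' ha' i hi j hj)]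
      exact l₁ a' ha' i hi j hj
    · intro i hi j hj
      have : progress 0 0 0 i j = 0 := by simp [progress]
      rw [this]
      exact ⟨two₂ i hi j hj.le, fun h => by norm_num [bestLink] at h⟩
  · rintro i hi s' ⟨c', ⟨k3, k12, k4⟩, l', p'⟩
    exact ⟨by simp only [Cond.Holds]; rw [k4, c'.n0]; exact hi,
      vertexCmd_spec c' k3 k12 k4 (by omega) l' p' hS⟩
  · rintro s' ⟨c', ⟨-, -, k4⟩, -⟩
    simp only [Cond.Holds]
    rw [k4, c'.n0]
    exact lt_irrefl _
  · rintro s' ⟨c', ⟨k3, k12, k4⟩, l', p'⟩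
    refine (testCmd_spec c' hm k12 ?_ hS).mono le_rfl ?_
    · intro a' ha' i hi j hj
      rcases Nat.lt_succ_iff_lt_or_eq.1 (Nat.lt_succ_of_le ha') with h | rfl
      · exact l' a' (by omega) i hi j hj
      · have := p' i hi j hj
        rwa [show progress (m + 1) 0 0 i j = i by simp [progress]; omega] at this
    · rintro s'' ⟨c'', k12', -, l'', e⟩
      exact ⟨c'', k12', l'', e⟩

end Verification
section Verification

variable {S m : ℕ} {ε : ℝ} {p : ℕ → Plane}

/-- The way back writes the vertex on level `l - k` to cell `l - k` of the integer memory. The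
output does not interfere with the predecessors, which are stored from address `4 * (m + 1)` on. -/
theorem traceCmd_spec {s : Store} (hctx : Ctx m ε p s) (hε : 0 ≤ ε) (hm : 0 < m) {l : ℕ}
    (hlm : l ≤ m) (h12 : s.n 12 = l) (hlev : Levels m ε p l s)
    (hl : (table ε p l m (m - 1)).1 ≤ 1) (hS : 2 * adr (m + 1) l m m + 1 < S) :
    Wp S traceCmd (l * 13 + 7) s fun s' => s'.n 0 = l + 1 ∧
      ∀ k ≤ l, s'.nm (l - k) = (trace ε p l m k).1 := by
  have hbig := two_mul_le_adr (m + 1) l m m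
  have hadr : ∀ a ≤ l, ∀ i ≤ m, ∀ j ≤ m, adr (m + 1) a i j ≤ adr (m + 1) l m m :=
    fun a ha i hi j hj => adr_le_adr ha hi hj
  let I : ℕ → Store → Prop := fun k s' => Ctx m ε p s' ∧
    (s'.n 3 = l + 1 ∧ s'.n 12 = l - k ∧ s'.n 4 = (trace ε p l m k).1 ∧
      s'.n 6 = (trace ε p l m k).2) ∧
    (∀ k' ≤ k, s'.nm (l - k') = (trace ε p l m k').1) ∧ ∀ A > l, s'.nm A = s.nm A
  rw [show l * 13 + 7 = 4 + ((l * (12 + 1) + 2) + 1) by ring]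
  refine Wp.seq (Q := I 0) (Wp.block (by decide) ?_) fun s₁ h₁ =>
    Wp.seq (Wp.loop (N := l) I h₁ ?_ ?_) ?_
  · have h1 := hctx.n1
    have h2 := hctx.n2
    have h16 := hctx.n16
    simp only [BlockPost]
    simp [h1, h2, h16, h12]
    refine ⟨by omega, by omega, by omega, by omega, hctx.of_agree (fun k hk => ?_)
      (fun _ _ => rfl) (fun _ _ => rfl), ⟨by simp, by simp [h12], by simp [trace], by simp [trace]⟩,
      fun k' hk' => ?_, fun A hA => ?_⟩
    · have : k ≠ 3 ∧ k ≠ 4 ∧ k ≠ 6 := by omega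
      simp [this]
    · obtain rfl : k' = 0 := by omega
      simp [trace]
    · have : A ≠ l := by omega
      simp [this]
  · rintro k hk s' ⟨c', ⟨g3, g12, g4, g6⟩, gout, gnm⟩
    have h0 := c'.n0
    have h2 := c'.n2
    have hle := trace_le hε hl hk.le
    have hle' := trace_le hε hl (k := k + 1) hk
    have hA := hadr (l - k) (by omega) _ hle.1 _ (hle.2.trans (Nat.sub_le m 1))
    have hA2 := two_mul_le_adr (m + 1) (l - k) (trace ε p l m k).1 (trace ε p l m k).2
    obtain ⟨-, hcell⟩ := hlev (l - k) (by omega) _ hle.1 (trace ε p l m k).2 (by omega)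
    obtain ⟨e1, e2⟩ := hcell (trace_table_le_one hε hl hk.le)
    refine ⟨by simp only [Cond.Holds]; rw [c'.n15, g12]; omega, Wp.block (by decide)
      (blockPost_adrCode (by decide) (by decide) (by omega) ?_ ?_)⟩ <;>
      rw [h0, g12, g4, g6]
    · omega
    · set A := adr (m + 1) (l - k) (trace ε p l m k).1 (trace ε p l m k).2
      rw [← gnm _ (by omega)] at e1 e2
      change s'.nm _ = (trace ε p l m (k + 1)).1 at e1
      change s'.nm _ = (trace ε p l m (k + 1)).2 at e2
      simp only [BlockPost]
      simp [← two_mul, h2, g12, e1, e2]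
      refine ⟨by omega, by omega, by omega, by omega, by omega,
        c'.of_agree (fun x hx => ?_) (fun _ _ => rfl) (fun _ _ => rfl),
        ⟨by simp [g3], by simp; omega, by simp, by simp⟩, fun k' hk' => ?_, fun D hD => ?_⟩
      · have : x ≠ 12 ∧ x ≠ 4 ∧ x ≠ 6 ∧ x ≠ 8 := by omega
        simp [this]
      · rcases Nat.lt_succ_iff_lt_or_eq.1 (Nat.lt_succ_of_le hk') with h | rfl
        · have : l - k' ≠ l - k - 1 := by omega
          simp [this, gout k' (by omega)]
        · simp [Nat.sub_sub]
      · have : D ≠ l - k - 1 := by omega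
        simp [this, gnm D hD]
  · rintro s' ⟨c', ⟨-, g12, -⟩, -⟩
    simp only [Cond.Holds]
    rw [c'.n15, g12]
    omega
  · rintro s' ⟨c', ⟨g3, -⟩, gout, -⟩
    refine Wp.block (by decide) ?_
    simp only [BlockPost]
    exact ⟨by omega, by simp [g3], fun k hk => by simpa using gout k hk⟩

/-- The search stops at the first level `l` at which the end of the input is reached; no larger
level is ever stored, so a machine whose size fits level `l` suffices. -/
theorem searchCmd_spec {s : Store} (hε : 0 ≤ ε) (hm : 0 < m) {l : ℕ} (hlm : l ≤ m)
    (hl : (table ε p l m (m - 1)).1 ≤ 1) (hmin : ∀ a < l, 1 < (table ε p a m (m - 1)).1)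
    (hS : 2 * adr (m + 1) l m m + 1 < S) (hn0 : s.n 0 = m + 1) (hn2 : s.n 2 = 1)
    (hn : ∀ k, k ≠ 0 → k ≠ 2 → s.n k = 0) (hr0 : s.r 0 = ε) (hr : ∀ k ≠ 0, s.r k = 0)
    (hnm : ∀ A, s.nm A = 0) (hv : ∀ k ≤ m, s.rm (2 * k) = p k 0 ∧ s.rm (2 * k + 1) = p k 1) :
    Wp S searchCmd ((l + 1) * (300 * (m + 1) ^ 3)) s fun s' => s'.n 0 = l + 1 ∧
      ∀ k ≤ l, s'.nm (l - k) = (trace ε p l m k).1 := by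
  have hadr : ∀ a ≤ l, 2 * adr (m + 1) a m m + 1 < S := fun a ha => by
    have : adr (m + 1) a m m ≤ adr (m + 1) l m m := adr_le_adr ha le_rfl le_rfl
    omega
  have hbig := two_mul_le_adr (m + 1) l m m
  have hS0 := hadr 0 (Nat.zero_le l)
  have hnn : (m + 1) * (m + 1) < S := by
    have e : adr (m + 1) 0 m m = (m + 1) * (m + 1) + m + (m + 1) := by
      unfold adr
      ring
    omega
  have hT : 5 + (((m + 1) * (m + 1) * 9 + 3) + (7 + (7 +
      ((l * (200 * (m + 1) ^ 3 + 1) + 2) + (l * 13 + 7))))) ≤ (l + 1) * (300 * (m + 1) ^ 3) := by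
    have h1 : 1 ≤ (m + 1) ^ 3 := Nat.one_le_pow _ _ m.succ_pos
    have h2 : (m + 1) * (m + 1) ≤ (m + 1) ^ 3 := by
      rw [← pow_two]
      exact Nat.pow_le_pow_right m.succ_pos (by norm_num)
    nlinarith [Nat.mul_le_mul_left l h1]
  let I : ℕ → Store → Prop := fun a s' => Ctx m ε p s' ∧ s'.n 12 = a ∧ Levels m ε p a s' ∧
    s'.r 19 = (table ε p a m (m - 1)).1
  refine Wp.mono (Wp.seq (T := 5) (Q := fun s' => Ctx m ε p s' ∧ s'.n 12 = 0 ∧ ∀ A, s'.nm A = 0)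
    (Wp.block (by decide) ?_) ?_) hT (fun _ h => h)
  · simp only [BlockPost]
    refine ⟨by omega, by simp [hn0]; omega, by simp [hn0, hn2]; omega, ⟨?_, ?_, ?_, ?_, ?_, ?_, ?_,
      ?_, ?_, ?_, hv⟩, ?_, hnm⟩ <;> simp [hn0, hn2, hn, hr0, hr]
    norm_num
  rintro s₁ ⟨c₁, g₁, z₁⟩
  refine Wp.seq (clearCmd_spec c₁ g₁ hS0) ?_
  rintro s₂ ⟨c₂, n₂, r₂, nm₂, -, two₂⟩
  have g₂ : s₂.n 12 = 0 := by simp [n₂, g₁]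
  have h0 := c₂.n0
  refine Wp.seq (T := 7) (Q := fun s' => Ctx m ε p s' ∧ s'.n 12 = 0 ∧ Levels m ε p 0 s')
    (Wp.block (by decide) (blockPost_adrCode (by decide) (by decide) (by omega) ?_ ?_)) ?_
  · rw [h0, g₂, c₂.n15]
    have : adr (m + 1) 0 0 0 ≤ adr (m + 1) 0 m m := adr_le_adr le_rfl (by omega) (by omega)
    omega
  · rw [h0, g₂, c₂.n15]
    have hle : adr (m + 1) 0 0 0 ≤ adr (m + 1) 0 m m := adr_le_adr le_rfl (by omega) (by omega)
    have hge := two_mul_le_adr (m + 1) 0 0 0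
    simp only [BlockPost]
    refine ⟨by simp; omega, c₂.of_agree (fun k hk => ?_) (fun _ _ => rfl) (fun A hA => ?_),
      by simp [g₂], ?_⟩
    · have : k ≠ 8 := by omega
      simp [this]
    · have : A ≠ adr (m + 1) 0 0 0 := by omega
      simp [this]
    · intro a ha i hi j hj
      obtain rfl : a = 0 := by omega
      refine ⟨?_, fun _ => by simp [nm₂, z₁, table]⟩
      by_cases hij : i = 0 ∧ j = 0
      · obtain ⟨rfl, rfl⟩ := hij
        simp [table, c₂.r2]
      · have hne : adr (m + 1) 0 i j ≠ adr (m + 1) 0 0 0 := fun e =>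
          hij (adr_inj (by omega) (by omega) (by omega) (by omega) e).2
        simp [hne, two₂ i hi j hj.le, table, hij]
  rintro s₃ ⟨c₃, g₃, l₃⟩
  refine Wp.seq (Q := I 0) ((testCmd_spec c₃ hm g₃ l₃ hS0).mono le_rfl ?_) fun s₄ h₄ =>
    Wp.seq (Wp.loop (N := l) I h₄ ?_ ?_) ?_
  · rintro s' ⟨c', g', -, l', e'⟩
    exact ⟨c', g', l', e'⟩
  · rintro a ha s' ⟨c', g', l', e'⟩
    exact ⟨by simp only [Cond.Holds]; rw [c'.r1, e']; exact hmin a ha,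
      levelCmd_spec c' hm g' l' (hadr (a + 1) ha)⟩
  · rintro s' ⟨c', -, -, e'⟩
    simp only [Cond.Holds]
    rw [c'.r1, e']
    exact not_lt.2 hl
  · rintro s' ⟨c', g', l', -⟩
    exact traceCmd_spec c' hε hm hlm g' l' hl hS

end Verification

/-- The data of the initial configuration. -/
noncomputable def inputStore {m : ℕ} (P : Fin (m + 1) → Plane) (ε : ℝ) : Store where
  n := (inputConfig P ε).nReg
  r := (inputConfig P ε).rReg
  nm := (inputConfig P ε).nMem
  rm := (inputConfig P ε).rMem

theorem inputStore_vertex {m : ℕ} (P : Fin (m + 1) → Plane) (ε : ℝ) {k : ℕ} (hk : k ≤ m) :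
    (inputStore P ε).rm (2 * k) = extendSeq P k 0 ∧
      (inputStore P ε).rm (2 * k + 1) = extendSeq P k 1 := by
  have e : extendSeq P k = P ⟨k, Nat.lt_succ_of_le hk⟩ := extendSeq_val P ⟨k, Nat.lt_succ_of_le hk⟩
  have d : (2 * k + 1) / 2 = k := by omega
  rw [e]
  constructor
  · simp [inputStore, inputConfig, hk]
  · simp [inputStore, inputConfig, d, hk, Nat.add_mod]

/-- A structured program that is followed by `halt` halts. -/
theorem Wp.haltsWithin {S : ℕ} {c : Cmd} {T : ℕ} {s : Store} {Q : Store → Prop}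
    (h : Wp S c T s Q) : ∃ s' pc, HaltsWithin S T (c.compile 0 ++ [.halt]) (s.config 0)
      (s'.config pc) ∧ Q s' := by
  obtain ⟨t, ht, s', hr, hq⟩ := h (c.compile 0 ++ [.halt]) 0 ⟨[], [.halt], by simp, rfl⟩
  refine ⟨s', _, ⟨t, ht, hr, ?_⟩, hq⟩
  simp [Halted, Store.config, ← c.length_compile 0]

theorem mainCmd_spec {S m : ℕ} {P : Fin (m + 1) → Plane} {ε : ℝ} (hε : 0 ≤ ε) (hm : 0 < m) {l : ℕ}
    (hlm : l ≤ m) (hl : (table ε (extendSeq P) l m (m - 1)).1 ≤ 1)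
    (hmin : ∀ a < l, 1 < (table ε (extendSeq P) a m (m - 1)).1)
    (hS : 2 * adr (m + 1) l m m + 1 < S) :
    Wp S mainCmd (1 + ((l + 1) * (300 * (m + 1) ^ 3) + 2)) (inputStore P ε) fun s' =>
      s'.n 0 = l + 1 ∧ ∀ k ≤ l, s'.nm (l - k) = (trace ε (extendSeq P) l m k).1 := by
  have hbig := two_mul_le_adr (m + 1) l m m
  refine Wp.seq (Q := fun s' => s' = (inputStore P ε).setN 2 1) (Wp.block (by decide) ?_) ?_
  · simp only [BlockPost]
    exact ⟨by omega, trivial⟩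
  rintro _ rfl
  refine Wp.cond (fun _ => searchCmd_spec hε hm hlm hl hmin hS ?_ ?_ ?_ ?_ ?_ ?_ ?_) (fun h => ?_)
  · simp [inputStore, inputConfig]
  · simp
  · intro k h0 h2
    simp [inputStore, inputConfig, h0, h2]
  · simp [inputStore, inputConfig]
  · intro k h0
    simp [inputStore, inputConfig, h0]
  · intro A
    simp [inputStore, inputConfig]
  · exact fun k hk => inputStore_vertex P ε hk
  · refine absurd ?_ h
    simp [Cond.Holds, inputStore, inputConfig]
    omega

end RealRAM

theorem mainTheorem1 :
    ∃ (prog : List RealRAM.Instr) (C : ℕ),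
      ∀ (m : ℕ) (P : Fin (m + 1) → Plane) (ε : ℝ), 0 ≤ ε →
        ∃ (l : ℕ) (σ : Fin (l + 1) → Fin (m + 1)) (c : RealRAM.Config),
          IsOptimalSimplification P ε σ ∧
          RealRAM.HaltsWithin (C * ((l + 1) * (m + 1) ^ 2)) (C * ((l + 1) * (m + 1) ^ 5)) prog
            (inputConfig P ε) c ∧
          IsOutput c σ := by
  -- The constant `303` comes from the running time; a factor `6` suffices for the memory.
  refine ⟨RealRAM.mainCmd.compile 0 ++ [.halt], 303, fun m P ε hε => ?_⟩
  rcases Nat.eq_zero_or_pos m with rfl | hm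
  · have hw : RealRAM.Wp (303 * ((0 + 1) * (0 + 1) ^ 2)) RealRAM.mainCmd
        (303 * ((0 + 1) * (0 + 1) ^ 5)) (RealRAM.inputStore P ε)
        fun s' => s'.n 0 = 1 ∧ s'.nm 0 = 0 := by
      refine RealRAM.Wp.mono (RealRAM.Wp.seq (T := 1) (U := 2)
        (Q := fun s' => s' = (RealRAM.inputStore P ε).setN 2 1)
        (RealRAM.Wp.block (by decide) ?_) ?_) (by norm_num) (fun _ h => h)
      · simp [RealRAM.BlockPost]
      · rintro _ rfl
        refine RealRAM.Wp.cond (T := 0) (fun h => absurd h ?_) fun _ =>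
          RealRAM.Wp.block (by decide) ?_
        · simp [RealRAM.Cond.Holds, RealRAM.inputStore, inputConfig]
        · simp [RealRAM.BlockPost, RealRAM.inputStore, inputConfig]
    obtain ⟨s', pc, hh, h1, h2⟩ := hw.haltsWithin
    refine ⟨0, id, s'.config pc, ⟨isSimplification_id P hε, fun l' τ _ => by omega⟩, hh, h1,
      fun j => ?_⟩
    have hj : (j : ℕ) = 0 := by omega
    rw [id, hj]
    exact h2
  · have hex : ∃ l, (table ε (extendSeq P) l m (m - 1)).1 ≤ 1 :=
      ⟨m, (isSimplification_id P hε).table_le_one hε hm⟩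
    obtain ⟨l, hl, hmin'⟩ : ∃ l, (table ε (extendSeq P) l m (m - 1)).1 ≤ 1 ∧
        ∀ a, (table ε (extendSeq P) a m (m - 1)).1 ≤ 1 → l ≤ a := by
      classical
      exact ⟨Nat.find hex, Nat.find_spec hex, fun a ha => Nat.find_min' hex ha⟩
    have hlm : l ≤ m := hmin' m ((isSimplification_id P hε).table_le_one hε hm)
    have hmin : ∀ a < l, 1 < (table ε (extendSeq P) a m (m - 1)).1 := fun a ha =>
      not_le.1 fun h => absurd (hmin' a h) (not_le.2 ha)
    have hS : 2 * RealRAM.adr (m + 1) l m m + 1 < 303 * ((l + 1) * (m + 1) ^ 2) := by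
      have h : RealRAM.adr (m + 1) l m m + 1 ≤ 3 * ((l + 1) * (m + 1) ^ 2) := by
        unfold RealRAM.adr
        ring_nf
        omega
      omega
    have hT : 1 + ((l + 1) * (300 * (m + 1) ^ 3) + 2) ≤ 303 * ((l + 1) * (m + 1) ^ 5) := by
      have h1 : (l + 1) * (m + 1) ^ 3 ≤ (l + 1) * (m + 1) ^ 5 :=
        Nat.mul_le_mul_left _ (Nat.pow_le_pow_right m.succ_pos (by norm_num))
      have h2 : 1 ≤ (l + 1) * (m + 1) ^ 5 := Nat.mul_pos l.succ_pos (Nat.pow_pos m.succ_pos)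
      rw [Nat.mul_left_comm]
      omega
    let σ : Fin (l + 1) → Fin (m + 1) := fun a =>
      ⟨(trace ε (extendSeq P) l m (l - a)).1,
        Nat.lt_succ_of_le (trace_le hε hl (Nat.sub_le l a)).1⟩
    obtain ⟨s', pc, hh, h0, hout⟩ :=
      ((RealRAM.mainCmd_spec hε hm hlm hl hmin hS).mono hT (fun _ h => h)).haltsWithin
    refine ⟨l, σ, s'.config pc, ⟨isSimplification_trace hε hm hl fun _ => rfl, fun l' τ hτ => ?_⟩,
      hh, h0, fun j => ?_⟩
    · exact Nat.succ_le_succ (hmin' l' (hτ.table_le_one hε hm))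
    · have hj := Nat.le_of_lt_succ j.2
      have := hout (l - j) (Nat.sub_le l j)
      rwa [Nat.sub_sub_self hj] at this
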